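/- Let $n\ge 1$ and let $\mathfrak S_n$ be the group of permutations of $\{1,\dots,n\}$, with product $\sigma\mu=\sigma\circ\mu$, simple transpositions $s_i=(i,i+1)$, length $\ell$ (the least number of factors in a product of simple transpositions), and maximal permutation $\omega=n\,(n-1)\cdots 1$. A transposition $\tau$ is a Bruhat transposition for $\sigma$ if $\ell(\sigma\tau)=\ell(\sigma)+1$; the Bruhat order $\le$ is the reflexive transitive closure of the relations $\sigma<\sigma\tau$ so obtained. Let $(K_\sigma)_{\sigma\in\mathfrak S_n}$ be the basis of a free module (over any nonzero commutative ring), with right operators $\pi_i,\hat\pi_i$ ($1\le i<n$) defined by $K_\sigma\pi_i=K_{\sigma s_i}$ if $\sigma(i)>\sigma(i+1)$, $K_\sigma\pi_i=K_\sigma$ otherwise, and $\hat\pi_i=\pi_i-1$; for a reduced decomposition $\tau=s_{i_1}\cdots s_{i_r}$ put $\pi_\tau=\pi_{i_1}\cdots\pi_{i_r}$ and $\hat\pi_\tau=\hat\pi_{i_1}\cdots\hat\pi_{i_r}$. Let $1\le k_1<k_2<\dots<k_m<n$, $k_0=0$, and $\sigma\in\mathfrak S_n$. Let $\mathcal W_i$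 be the list of the transpositions $(a,b)$ with $k_{i-1}<a\le k_i<b\le n$, ordered by increasing $a$ and, for equal $a$, by decreasing $b$, and let $\mathcal W_{(k_1,\dots,k_m)}$ be the concatenation of $\mathcal W_m,\mathcal W_{m-1},\dots,\mathcal W_1$ in this order. Call a subword $w=\tau_1\cdots\tau_r$ of $\mathcal W_{(k_1,\dots,k_m)}$ valid if each $\tau_j$ is a Bruhat transposition for $\sigma\tau_1\cdots\tau_{j-1}$; write $|w|=r$ and $\sigma w=\sigma\tau_1\cdots\tau_r$. The coset $\sigma(\mathfrak S_{k_1}\times\mathfrak S_{k_2-k_1}\times\dots\times\mathfrak S_{n-k_m})$ has a unique maximal element $\zeta$ for the Bruhat order, and $$K_\omega\,\hat\pi_{\omega\zeta}\,\pi_{\zeta^{-1}\sigma}=\sum_{w\text{ valid}}(-1)^{|w|}K_{\sigma w},$$ for any choice of the reduced decompositions of $\omega\zeta$ and $\zeta^{-1}\sigma$. This sum has no cancellation: each permutation equals $\sigma w$ for at most one valid $w$. Its coefficients on the set $\{\sigma w : w\text{ valid}\}$ are all $1$ or $-1$, and this set is closed under intervals: if $\nu_1\le\mu\le\nu_2$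 and $\nu_1,\nu_2$ belong to it, so does $\mu$. In general this set is not an interval: there are $n$, $k_1<\dots<k_m$ and $\sigma\in\mathfrak S_n$ for which it is not of the form $\{\mu:\alpha\le\mu\le\beta\}$. -/

import Mathlib

namespace ZeroHecke

/-! Permutations of `{1, …, n}` are `Equiv.Perm (Fin n)`: the position (or value)
`p ∈ {1, …, n}` is the element of `Fin n` with underlying natural number `p - 1`.  The product `σ * τ` is
`σ ∘ τ`, so multiplying by a transposition on the right exchanges two positions. -/

/-- The simple transposition exchanging the (0-indexed) positions `i` and `i + 1`. -/
def simple {n : ℕ} (i : Fin (n - 1)) : Equiv.Perm (Fin n) :=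
  Equiv.swap ⟨i.val, by omega⟩ ⟨i.val + 1, by omega⟩

/-- The permutation `s_{i₁} s_{i₂} ⋯ s_{iᵣ}` of a word `i₁ i₂ … iᵣ`. -/
def wordProd {n : ℕ} (u : List (Fin (n - 1))) : Equiv.Perm (Fin n) :=
  (u.map simple).prod

/-- The length of a permutation: the least number of factors in a decomposition of it as a product
of simple transpositions. -/
noncomputable def len {n : ℕ} (σ : Equiv.Perm (Fin n)) : ℕ :=
  sInf {r | ∃ u : List (Fin (n - 1)), wordProd u = σ ∧ u.length = r}

/-- `u` is a reduced decomposition of `σ`. -/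
def IsReducedWord {n : ℕ} (u : List (Fin (n - 1))) (σ : Equiv.Perm (Fin n)) : Prop :=
  wordProd u = σ ∧ u.length = len σ

/-- Every permutation is a product of simple transpositions (so `len` is a true minimum). -/
theorem exists_word {n : ℕ} (σ : Equiv.Perm (Fin n)) :
    ∃ u : List (Fin (n - 1)), wordProd u = σ := by
  rcases n with _ | n
  · exact ⟨[], Subsingleton.elim _ _⟩
  · have h : σ ∈ Submonoid.closure
        (Set.range fun i : Fin n => Equiv.swap i.castSucc i.succ) := by
      rw [Equiv.Perm.mclosure_swap_castSucc_succ]; trivial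
    induction h using Submonoid.closure_induction with
    | mem x hx =>
      obtain ⟨i, rfl⟩ := hx
      exact ⟨[i], by simp [wordProd, simple]; rfl⟩
    | one => exact ⟨[], rfl⟩
    | mul x y _ _ hx hy =>
      obtain ⟨u, rfl⟩ := hx
      obtain ⟨v, rfl⟩ := hy
      exact ⟨u ++ v, by simp [wordProd]⟩

/-- Every permutation has a reduced decomposition. -/
theorem exists_isReducedWord {n : ℕ} (σ : Equiv.Perm (Fin n)) :
    ∃ u : List (Fin (n - 1)), IsReducedWord u σ := by
  obtain ⟨v, hv⟩ := exists_word σ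
  exact Nat.sInf_mem
    (s := {r | ∃ u : List (Fin (n - 1)), wordProd u = σ ∧ u.length = r}) ⟨_, v, hv, rfl⟩

/-- `τ` is a Bruhat transposition for `σ`: right multiplication of `σ` by the transposition `τ`
raises the length by exactly one, that is, `σ * τ` covers `σ` in the Bruhat order. -/
def IsBruhatTransposition {n : ℕ} (σ τ : Equiv.Perm (Fin n)) : Prop :=
  τ.IsSwap ∧ len (σ * τ) = len σ + 1

/-- The (strong) Bruhat order: the reflexive transitive closure of the covering relation. -/
def BruhatLE {n : ℕ} : Equiv.Perm (Fin n) → Equiv.Perm (Fin n) → Prop :=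
  Relation.ReflTransGen fun σ μ => ∃ τ, IsBruhatTransposition σ τ ∧ μ = σ * τ

/-- The maximal permutation `n (n-1) … 1`. -/
def omega (n : ℕ) : Equiv.Perm (Fin n) := Fin.revPerm

/-- The subgroup `S_{k₁} × S_{k₂-k₁} × ⋯ × S_{n-kₘ}` of `S_n`: the permutations that
preserve each of the blocks of positions cut out by `k₁ < ⋯ < kₘ`, equivalently each of the initial
segments `{1, …, kⱼ}`. -/
def parabolic {n m : ℕ} (k : Fin m → ℕ) : Subgroup (Equiv.Perm (Fin n)) where
  carrier := {g | ∀ (j : Fin m) (x : Fin n), (g x).val < k j ↔ x.val < k j}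
  one_mem' := fun _ _ => Iff.rfl
  mul_mem' := fun ha hb j x => (ha j _).trans (hb j x)
  inv_mem' := by
    intro g hg j x
    have h := hg j (g⁻¹ x)
    have e : g (g⁻¹ x) = x := g.apply_symm_apply x
    rw [e] at h
    exact h.symm

/-- `ζ` is the maximal element, for the Bruhat order, of the coset
`σ (S_{k₁} × S_{k₂-k₁} × ⋯ × S_{n-kₘ})`. -/
def IsCosetMax {n m : ℕ} (k : Fin m → ℕ) (σ ζ : Equiv.Perm (Fin n)) : Prop :=
  σ⁻¹ * ζ ∈ parabolic (n := n) k ∧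
    ∀ μ : Equiv.Perm (Fin n), σ⁻¹ * μ ∈ parabolic (n := n) k → BruhatLE μ ζ

/-- The free module on the basis `(K_σ)`, `σ ∈ S_n`. -/
abbrev KSpace (R : Type*) [CommRing R] (n : ℕ) : Type _ := Equiv.Perm (Fin n) →₀ R

/-- The basis vector `K_σ`. -/
noncomputable def K (R : Type*) [CommRing R] {n : ℕ} (σ : Equiv.Perm (Fin n)) : KSpace R n :=
  Finsupp.single σ 1

/-- The operator `π_i`: `K_σ π_i = K_{σ s_i}` if `σ_i > σ_{i+1}`, and `K_σ π_i = K_σ` otherwise. -/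
noncomputable def piOp (R : Type*) [CommRing R] {n : ℕ} (i : Fin (n - 1)) :
    KSpace R n →ₗ[R] KSpace R n :=
  Finsupp.linearCombination R fun σ : Equiv.Perm (Fin n) =>
    if σ ⟨i.val + 1, by omega⟩ < σ ⟨i.val, by omega⟩ then K R (σ * simple i) else K R σ

/-- The operator `π̂_i = π_i - 1`. -/
noncomputable def piHatOp (R : Type*) [CommRing R] {n : ℕ} (i : Fin (n - 1)) :
    KSpace R n →ₗ[R] KSpace R n :=
  piOp R i - LinearMap.id

/-- The right action `f π_{i₁} π_{i₂} ⋯ π_{iᵣ}` (the leftmost letter acts first). -/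
noncomputable def piWord {R : Type*} [CommRing R] {n : ℕ} (f : KSpace R n)
    (u : List (Fin (n - 1))) : KSpace R n :=
  u.foldl (fun g i => piOp R i g) f

/-- The right action `f π̂_{i₁} π̂_{i₂} ⋯ π̂_{iᵣ}` (the leftmost letter acts first). -/
noncomputable def piHatWord {R : Type*} [CommRing R] {n : ℕ} (f : KSpace R n)
    (u : List (Fin (n - 1))) : KSpace R n :=
  u.foldl (fun g i => piHatOp R i g) f

/-- The previous cut point, with the convention `k₀ = 0`. -/
def prevCut {m : ℕ} (k : Fin m → ℕ) (i : Fin m) : ℕ :=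
  if i.val = 0 then 0 else k ⟨i.val - 1, by omega⟩

/-- The list `𝒲_i`, where the pair `(a, b)` stands for the transposition of positions `a`, `b`:
`a` increases through `k_{i-1} + 1, …, k_i`, and for each `a`,
`b` decreases through `n, n - 1, …, k_i + 1` (1-indexed). -/
def blockList (n : ℕ) {m : ℕ} (k : Fin m → ℕ) (i : Fin m) : List (Fin n × Fin n) :=
  ((List.finRange n).filter fun a => prevCut k i ≤ a.val ∧ a.val < k i).flatMap fun a =>
    ((List.finRange n).reverse.filter fun b => k i ≤ b.val).map fun b => (a, b)

/-- The list `𝒲_{(k₁, …, kₘ)}`, the concatenation of `𝒲_m, 𝒲_{m-1}, …, 𝒲_1`. -/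
def transpList (n : ℕ) {m : ℕ} (k : Fin m → ℕ) : List (Fin n × Fin n) :=
  (List.finRange m).reverse.flatMap fun i => blockList n k i

/-- The permutation `σ w = σ τ₁ τ₂ ⋯ τᵣ` for a word `w = τ₁ τ₂ … τᵣ` on transpositions. -/
def mulWord {n : ℕ} (σ : Equiv.Perm (Fin n)) (w : List (Fin n × Fin n)) : Equiv.Perm (Fin n) :=
  σ * (w.map fun p => Equiv.swap p.1 p.2).prod

/-- The word `w = τ₁ … τᵣ` is a path in the Bruhat order starting from `σ`: each of
`σ, σ τ₁, σ τ₁ τ₂, …` is covered by the next one. -/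
def IsBruhatPath {n : ℕ} : Equiv.Perm (Fin n) → List (Fin n × Fin n) → Prop
  | _, [] => True
  | σ, p :: w => IsBruhatTransposition σ (Equiv.swap p.1 p.2) ∧
      IsBruhatPath (σ * Equiv.swap p.1 p.2) w

open Classical in
/-- The subwords of `𝒲_{(k₁, …, kₘ)}` that are paths in the Bruhat order starting from `σ`.
(The list has no repeated entry, so its subwords are determined by their letters.) -/
noncomputable def validSubwords {n m : ℕ} (k : Fin m → ℕ) (σ : Equiv.Perm (Fin n)) :
    Finset (List (Fin n × Fin n)) :=
  (transpList n k).sublists.toFinset.filter fun w => IsBruhatPath σ w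

/-- The sum `∑ (-1)^{|w|} K_{σ w}` over the valid subwords `w`. -/
noncomputable def chainSum (R : Type*) [CommRing R] {n m : ℕ} (k : Fin m → ℕ)
    (σ : Equiv.Perm (Fin n)) : KSpace R n :=
  ∑ w ∈ validSubwords k σ, ((-1 : R) ^ w.length) • K R (mulWord σ w)

/-- The set of permutations `σ w` indexing the sum. -/
def summationSet {n m : ℕ} (k : Fin m → ℕ) (σ : Equiv.Perm (Fin n)) :
    Set (Equiv.Perm (Fin n)) :=
  {ν | ∃ w ∈ validSubwords k σ, mulWord σ w = ν}

end ZeroHecke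

/-! The alternating sum comes from operators. Let `X R a b` send K_σ to K_σ - K_{σ(a b)} if (a b) is
a Bruhat transposition for σ, and to K_σ otherwise. Expanding a product of such operators along a
list gives the signed sum over valid subwords (`act_listOp_eq_sum`). The operators commute for
disjoint pairs and satisfy the Yang-Baxter relation (`X_yang_baxter`), so the product F over all
pairs a < b can be reordered.

Two reorderings matter. First, F = X_{i,i+1} T with T commuting with π_i (`full_eq_X_mul`). This
gives K_{σ s_i} F = K_σ F (π_i - 1) at a descent i of σ; since K_ω F = K_ω, it follows that K_ω π̂_τ
= K_{ωτ} F (`piHatWord_omega`). Second, F = I W, where I involves only pairs inside a common block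
and W is the product over 𝒲 (`full_eq_mul_transpList`). The coset maximum ζ has only descents inside
blocks, so I fixes K_ζ and K_ω π̂_{ωζ} = K_ζ W. As W commutes with π_i whenever i is not a cut
(`Pi_commute_transpList`), applying π_{ζ⁻¹σ} turns this into K_σ W (`expansion`).

For uniqueness, the same recursion over ℤ and the lifting property of the Bruhat order show that the
coefficient of K_μ in K_σ F is ±1 if σ ≤ μ and 0 otherwise (`act_full_apply`). All paths from σ to μ
carry the same sign, so each Bruhat relation is realised by exactly one subword of the list of I W
(`pathCount_eq_ite`), hence by at most one subword of 𝒲.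

Cutting this unique path between I and W shows that distinct elements of one coset have disjoint
sets of endpoints (`eq_of_pathCount_pos`). Hence μ is an endpoint for σ exactly when σ is the
greatest element of its coset below μ (`pathCount_transpList_pos_iff`). Half of this condition
persists upwards and half downwards, which gives closure under intervals. An example in S_4 with two
endpoints of maximal length shows that the set need not be an interval. -/

namespace ZeroHecke

open Equiv

/-! ### Length as number of inversions, and covers in the Bruhat order -/

section Length

variable {n : ℕ}

/-- The number of inversions of a permutation. -/
def inv (σ : Perm (Fin n)) : ℕ :=
  (Finset.univ.filter fun p : Fin n × Fin n => p.1 < p.2 ∧ σ p.2 < σ p.1).card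

/-- Exchanging adjacent positions keeps the relative order of every pair of positions except the
exchanged pair itself, so the inversions are transported bijectively and that pair is the only new
one. -/
theorem inv_mul_swap_of_adjacent {σ : Perm (Fin n)} {i j : Fin n} (hij : j.val = i.val + 1)
    (h : σ i < σ j) : inv (σ * swap i j) = inv σ + 1 := by
  have key : (Finset.univ.filter fun p : Fin n × Fin n =>
      p.1 < p.2 ∧ (σ * swap i j) p.2 < (σ * swap i j) p.1) =
      insert (i, j) ((Finset.univ.filter fun p : Fin n × Fin n =>
        p.1 < p.2 ∧ σ p.2 < σ p.1).map
          ((Equiv.prodCongr (swap i j) (swap i j)).toEmbedding)) := by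
    ext ⟨p, q⟩
    rw [Finset.mem_insert, Finset.mem_map_equiv, Finset.mem_filter, Finset.mem_filter]
    simp only [Finset.mem_univ, true_and, Equiv.prodCongr_symm, symm_swap, Equiv.prodCongr_apply,
      Prod.map_apply, Perm.mul_apply, Prod.mk.injEq]
    by_cases hp : p = i ∧ q = j
    · obtain ⟨rfl, rfl⟩ := hp
      simp [h]
      omega
    by_cases hq : p = j ∧ q = i
    · obtain ⟨rfl, rfl⟩ := hq
      simp only [swap_apply_left, swap_apply_right]
      constructor
      · intro h'; omega
      · rintro (h' | h')
        · omega
        · exact absurd h'.2 (not_lt.2 h.le)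
    have : p < q ↔ swap i j p < swap i j q := by
      simp only [swap_apply_def]
      split_ifs <;> omega
    rw [this]
    tauto
  rw [inv, key, Finset.card_insert_of_notMem, Finset.card_map]
  · rfl
  · simp only [Finset.mem_map_equiv, Equiv.prodCongr_symm, symm_swap, Equiv.prodCongr_apply,
      Prod.map_apply, swap_apply_left, swap_apply_right, Finset.mem_filter, Finset.mem_univ,
      true_and, not_and]
    intro h'; omega

theorem inv_mul_swap_of_adjacent' {σ : Perm (Fin n)} {i j : Fin n} (hij : j.val = i.val + 1)
    (h : σ j < σ i) : inv (σ * swap i j) + 1 = inv σ := by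
  have := inv_mul_swap_of_adjacent (σ := σ * swap i j) hij (by simpa using h)
  rw [← this, mul_assoc, swap_mul_self, mul_one]

theorem inv_one : inv (1 : Perm (Fin n)) = 0 := by
  rw [inv, Finset.card_eq_zero, Finset.filter_eq_empty_iff]
  rintro p - ⟨h1, h2⟩
  exact absurd h1 (not_lt.2 h2.le)

/-- The left position of the simple transposition `simple i`. -/
abbrev pos (i : Fin (n - 1)) : Fin n := ⟨i.val, by omega⟩

/-- The right position of the simple transposition `simple i`. -/
abbrev pos' (i : Fin (n - 1)) : Fin n := ⟨i.val + 1, by omega⟩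

theorem simple_eq (i : Fin (n - 1)) : simple i = swap (pos i) (pos' i) := rfl

@[simp] theorem simple_mul_self (i : Fin (n - 1)) : simple i * simple i = 1 := swap_mul_self _ _

@[simp] theorem mul_simple_mul_simple (σ : Perm (Fin n)) (i : Fin (n - 1)) :
    σ * simple i * simple i = σ := by rw [mul_assoc, simple_mul_self, mul_one]

@[simp] theorem simple_pos (i : Fin (n - 1)) : simple i (pos i) = pos' i := swap_apply_left _ _

@[simp] theorem simple_pos' (i : Fin (n - 1)) : simple i (pos' i) = pos i := swap_apply_right _ _

theorem pos_lt (i : Fin (n - 1)) : pos i < pos' i := by simp [Fin.lt_def]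

theorem apply_pos_ne (σ : Perm (Fin n)) (i : Fin (n - 1)) : σ (pos i) ≠ σ (pos' i) :=
  fun h => (pos_lt i).ne (σ.injective h)

theorem inv_mul_simple {σ : Perm (Fin n)} {i : Fin (n - 1)} (h : σ (pos i) < σ (pos' i)) :
    inv (σ * simple i) = inv σ + 1 := inv_mul_swap_of_adjacent rfl h

theorem inv_mul_simple' {σ : Perm (Fin n)} {i : Fin (n - 1)} (h : σ (pos' i) < σ (pos i)) :
    inv (σ * simple i) + 1 = inv σ := inv_mul_swap_of_adjacent' rfl h

theorem inv_mul_simple_le (σ : Perm (Fin n)) (i : Fin (n - 1)) :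
    inv (σ * simple i) ≤ inv σ + 1 := by
  rcases lt_or_gt_of_ne (apply_pos_ne σ i) with h | h
  · exact (inv_mul_simple h).le
  · have := inv_mul_simple' h; omega

theorem wordProd_concat (u : List (Fin (n - 1))) (i : Fin (n - 1)) :
    wordProd (u ++ [i]) = wordProd u * simple i := by simp [wordProd]

theorem inv_wordProd_le (u : List (Fin (n - 1))) : inv (wordProd u) ≤ u.length := by
  induction u using List.reverseRecOn with
  | nil => exact inv_one.le
  | append_singleton u i ih =>
    rw [wordProd_concat, List.length_append, List.length_singleton]
    exact (inv_mul_simple_le _ _).trans (by omega)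

/-- A monotonicity along adjacent positions extends to a convex set of positions. -/
theorem lt_of_adjacent {P : Fin n → Fin n → Prop} (htrans : ∀ a b c, P a b → P b c → P a c)
    {a b : Fin n} (hab : a < b)
    (h : ∀ i : Fin (n - 1), a ≤ pos i → pos' i ≤ b → P (pos i) (pos' i)) : P a b := by
  obtain ⟨d, hd⟩ : ∃ d, b.val = a.val + d + 1 := ⟨b.val - a.val - 1, by omega⟩
  induction d generalizing b with
  | zero =>
    have := h ⟨a.val, by omega⟩ (by simp) (by simp [Fin.le_def, hd])
    convert this using 1
    ext; simp [hd]
  | succ d ih =>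
    have h1 := ih (b := ⟨b.val - 1, by omega⟩) (by rw [Fin.lt_def]; simp; omega)
      (fun i hi hi' => h i hi (hi'.trans (by simp [Fin.le_def]))) (by simp; omega)
    have h2 := h ⟨b.val - 1, by omega⟩ (by simp [Fin.le_def]; omega)
      (by simp [Fin.le_def]; omega)
    refine htrans _ _ _ h1 ?_
    convert h2 using 1
    ext; simp; omega

theorem eq_one_of_strictMono {g : Perm (Fin n)} (h : ∀ a b, a < b → g a < g b) : g = 1 := by
  have : (StrictMono.orderIsoOfSurjective g h g.surjective) = OrderIso.refl _ :=
    Subsingleton.elim _ _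
  ext x
  exact congrArg (fun f : Fin n ≃o Fin n => (f x).val) this

theorem exists_descent {σ : Perm (Fin n)} (h : σ ≠ 1) :
    ∃ i : Fin (n - 1), σ (pos' i) < σ (pos i) := by
  by_contra! hc
  refine h (eq_one_of_strictMono fun a b hab => ?_)
  exact lt_of_adjacent (P := fun a b => σ a < σ b) (fun _ _ _ => lt_trans) hab
    fun i _ _ => lt_of_le_of_ne (hc i) (apply_pos_ne σ i)

theorem exists_word_length_eq_inv (σ : Perm (Fin n)) :
    ∃ u : List (Fin (n - 1)), wordProd u = σ ∧ u.length = inv σ := by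
  generalize hr : inv σ = r
  induction r generalizing σ with
  | zero =>
    by_cases h : σ = 1
    · exact ⟨[], h ▸ rfl, rfl⟩
    · obtain ⟨i, hi⟩ := exists_descent h
      have := inv_mul_simple' hi
      omega
  | succ r ih =>
    have h : σ ≠ 1 := by rintro rfl; simp [inv_one] at hr
    obtain ⟨i, hi⟩ := exists_descent h
    have := inv_mul_simple' hi
    obtain ⟨u, hu, hl⟩ := ih (σ * simple i) (by omega)
    exact ⟨u ++ [i], by rw [wordProd_concat, hu, mul_simple_mul_simple], by simp [hl]⟩

theorem len_eq_inv (σ : Perm (Fin n)) : len σ = inv σ := by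
  apply le_antisymm
  · exact Nat.sInf_le (exists_word_length_eq_inv σ)
  · obtain ⟨u, rfl, hl⟩ := exists_isReducedWord σ
    rw [← hl]
    exact inv_wordProd_le u

/-- The count shows that the length grows by exactly one precisely when no position in between
carries a value in between, which turns Bruhat transpositions into the local condition `Cov`. -/
theorem inv_mul_swap {σ : Perm (Fin n)} {a b : Fin n} (hab : a < b) (h : σ a < σ b) :
    inv (σ * swap a b) = inv σ + 1 + 2 * (Finset.univ.filter fun c : Fin n =>
      (a < c ∧ c < b) ∧ σ a < σ c ∧ σ c < σ b).card := by
  obtain ⟨d, hd⟩ : ∃ d, b.val = a.val + d + 1 := ⟨b.val - a.val - 1, by omega⟩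
  induction d generalizing b σ with
  | zero =>
    rw [inv_mul_swap_of_adjacent (by omega) h, Finset.card_eq_zero.2, mul_zero, add_zero]
    rw [Finset.filter_eq_empty_iff]
    rintro c - ⟨⟨h1, h2⟩, -⟩
    omega
  | succ d ih =>
    set b' : Fin n := ⟨b.val - 1, by omega⟩ with hb'
    have hbb : b.val = b'.val + 1 := by simp [hb']; omega
    have hab' : a < b' := by rw [Fin.lt_def]; omega
    have hbb' : b' < b := by rw [Fin.lt_def]; omega
    have e1 : (σ * swap b' b) a = σ a := by
      rw [Perm.mul_apply, swap_apply_of_ne_of_ne hab'.ne hab.ne]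
    have e2 : (σ * swap b' b) b' = σ b := by simp
    have e3 : (σ * swap b' b) b = σ b' := by simp
    -- Conjugating by the adjacent exchange of b - 1 and b shortens the distance by one. The two
    -- outer exchanges change the length in the same direction exactly when b - 1 carries a value in
    -- between.
    have hs : σ * swap a b = σ * swap b' b * swap a b' * swap b' b := by
      rw [mul_assoc, mul_assoc, ← mul_assoc (swap b' b), swap_mul_swap_mul_swap hab'.ne hab.ne,
        swap_comm]
    have h1 := ih (σ := σ * swap b' b) (b := b') hab' (by rw [e1, e2]; exact h) (by omega)
    have e4 : (σ * swap b' b * swap a b') b' = σ a := by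
      rw [Perm.mul_apply, swap_apply_right, e1]
    have e5 : (σ * swap b' b * swap a b') b = σ b' := by
      rw [Perm.mul_apply, swap_apply_of_ne_of_ne hab.ne' hbb'.ne', e3]
    have hne1 : σ a ≠ σ b' := fun h => hab'.ne (σ.injective h)
    have hne2 : σ b' ≠ σ b := fun h => hbb'.ne (σ.injective h)
    have hfil : (Finset.univ.filter fun c : Fin n =>
        (a < c ∧ c < b') ∧ (σ * swap b' b) a < (σ * swap b' b) c ∧
          (σ * swap b' b) c < (σ * swap b' b) b') =
        (Finset.univ.filter fun c : Fin n =>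
          (a < c ∧ c < b) ∧ σ a < σ c ∧ σ c < σ b).erase b' := by
      ext c
      simp only [Finset.mem_filter, Finset.mem_univ, true_and, Finset.mem_erase, e1, e2]
      by_cases hc : c = b'
      · simp [hc]
      by_cases hc' : c = b
      · simp [hc', hbb'.le]
      rw [Perm.mul_apply, swap_apply_of_ne_of_ne hc hc']
      have : c < b' ↔ c < b := by
        have : c.val ≠ b'.val := fun h => hc (Fin.ext h)
        rw [Fin.lt_def, Fin.lt_def]; omega
      rw [this]; tauto
    rw [hfil] at h1
    rw [hs]
    by_cases hm : σ a < σ b' ∧ σ b' < σ b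
    · have hmem : b' ∈ (Finset.univ.filter fun c : Fin n =>
          (a < c ∧ c < b) ∧ σ a < σ c ∧ σ c < σ b) := by simp [hab', hbb', hm]
      have hcard := Finset.card_erase_add_one hmem
      have h2 := inv_mul_swap_of_adjacent hbb hm.2
      have h3 := inv_mul_swap_of_adjacent (σ := σ * swap b' b * swap a b') hbb
        (by rw [e4, e5]; exact hm.1)
      omega
    · rw [Finset.erase_eq_of_notMem (by simp only [Finset.mem_filter]; tauto)] at h1
      rcases lt_or_gt_of_ne hne1 with h4 | h4
      · have h5 : σ b < σ b' := lt_of_le_of_ne (not_lt.1 fun h' => hm ⟨h4, h'⟩) hne2.symm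
        have h2 := inv_mul_swap_of_adjacent' hbb h5
        have h3 := inv_mul_swap_of_adjacent (σ := σ * swap b' b * swap a b') hbb
          (by rw [e4, e5]; exact h4)
        omega
      · have h2 := inv_mul_swap_of_adjacent hbb (h4.trans h)
        have h3 := inv_mul_swap_of_adjacent' (σ := σ * swap b' b * swap a b') hbb
          (by rw [e4, e5]; exact h4)
        omega

/-- The transposition of the positions `a < b` is a Bruhat transposition for `σ`: the value at `a`
is less than the value at `b`, and no position in between carries a value in between. -/
def Cov (σ : Perm (Fin n)) (a b : Fin n) : Prop :=
  a < b ∧ σ a < σ b ∧ ∀ c, a < c → c < b → σ a < σ c → σ c < σ b → False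

instance (σ : Perm (Fin n)) (a b : Fin n) : Decidable (Cov σ a b) := by
  unfold Cov; infer_instance

theorem Cov.inv_eq {σ : Perm (Fin n)} {a b : Fin n} (h : Cov σ a b) :
    inv (σ * swap a b) = inv σ + 1 := by
  rw [inv_mul_swap h.1 h.2.1, Finset.card_eq_zero.2, mul_zero, add_zero]
  rw [Finset.filter_eq_empty_iff]
  rintro c - ⟨⟨h1, h2⟩, h3, h4⟩
  exact h.2.2 c h1 h2 h3 h4

theorem isBruhatTransposition_swap {σ : Perm (Fin n)} {a b : Fin n} (hab : a < b) :
    IsBruhatTransposition σ (swap a b) ↔ Cov σ a b := by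
  constructor
  · rintro ⟨-, h⟩
    rw [len_eq_inv, len_eq_inv] at h
    rcases lt_or_gt_of_ne (fun h => hab.ne (σ.injective h) : σ a ≠ σ b) with h1 | h1
    · rw [inv_mul_swap hab h1] at h
      refine ⟨hab, h1, fun c hc hc' h2 h3 => ?_⟩
      have : (Finset.univ.filter fun c : Fin n =>
        (a < c ∧ c < b) ∧ σ a < σ c ∧ σ c < σ b).card = 0 := by omega
      rw [Finset.card_eq_zero, Finset.filter_eq_empty_iff] at this
      exact this (Finset.mem_univ c) ⟨⟨hc, hc'⟩, h2, h3⟩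
    · have := inv_mul_swap (σ := σ * swap a b) hab (by simpa using h1)
      rw [mul_assoc, swap_mul_self, mul_one] at this
      omega
  · intro h
    exact ⟨⟨a, b, hab.ne, rfl⟩, by rw [len_eq_inv, len_eq_inv, h.inv_eq]⟩

theorem exists_cov_iff {σ μ : Perm (Fin n)} :
    (∃ τ, IsBruhatTransposition σ τ ∧ μ = σ * τ) ↔ ∃ a b, Cov σ a b ∧ μ = σ * swap a b := by
  constructor
  · rintro ⟨τ, h, rfl⟩
    obtain ⟨a, b, hab, rfl⟩ := h.1
    rcases lt_or_gt_of_ne hab with h' | h'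
    · exact ⟨a, b, (isBruhatTransposition_swap h').1 h, rfl⟩
    · rw [swap_comm] at h ⊢
      exact ⟨b, a, (isBruhatTransposition_swap h').1 h, rfl⟩
  · rintro ⟨a, b, h, rfl⟩
    exact ⟨swap a b, (isBruhatTransposition_swap h.1).2 h, rfl⟩

theorem cov_simple {σ : Perm (Fin n)} {i : Fin (n - 1)} :
    Cov σ (pos i) (pos' i) ↔ σ (pos i) < σ (pos' i) := by
  refine ⟨fun h => h.2.1, fun h => ⟨pos_lt i, h, fun c h1 h2 => ?_⟩⟩
  simp only [Fin.lt_def] at h1 h2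
  omega

theorem bruhatLE_refl (σ : Perm (Fin n)) : BruhatLE σ σ := Relation.ReflTransGen.refl

theorem BruhatLE.trans {σ μ ν : Perm (Fin n)} (h : BruhatLE σ μ) (h' : BruhatLE μ ν) :
    BruhatLE σ ν := Relation.ReflTransGen.trans h h'

theorem Cov.bruhatLE {σ : Perm (Fin n)} {a b : Fin n} (h : Cov σ a b) :
    BruhatLE σ (σ * swap a b) :=
  Relation.ReflTransGen.single (exists_cov_iff.2 ⟨a, b, h, rfl⟩)

theorem bruhatLE_mul_simple {σ : Perm (Fin n)} {i : Fin (n - 1)} (h : σ (pos i) < σ (pos' i)) :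
    BruhatLE σ (σ * simple i) := (cov_simple.2 h).bruhatLE

theorem mul_simple_bruhatLE {σ : Perm (Fin n)} {i : Fin (n - 1)} (h : σ (pos' i) < σ (pos i)) :
    BruhatLE (σ * simple i) σ := by
  have := bruhatLE_mul_simple (σ := σ * simple i) (i := i) (by simpa using h)
  simpa using this

/-- Induction along the covers of a Bruhat chain. -/
theorem BruhatLE.induction {σ : Perm (Fin n)} {P : Perm (Fin n) → Prop} (h0 : P σ)
    (hs : ∀ μ a b, BruhatLE σ μ → Cov μ a b → P μ → P (μ * swap a b)) {ν : Perm (Fin n)}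
    (h : BruhatLE σ ν) : P ν := by
  induction h with
  | refl => exact h0
  | tail h1 h2 ih =>
    obtain ⟨a, b, hc, rfl⟩ := exists_cov_iff.1 h2
    exact hs _ _ _ h1 hc ih

theorem BruhatLE.eq_or_inv_lt {σ μ : Perm (Fin n)} (h : BruhatLE σ μ) : σ = μ ∨ inv σ < inv μ := by
  refine h.induction (P := fun μ => σ = μ ∨ inv σ < inv μ) (Or.inl rfl) ?_
  rintro μ a b - hc h
  right
  rw [hc.inv_eq]
  rcases h with rfl | h <;> omega

theorem BruhatLE.inv_le {σ μ : Perm (Fin n)} (h : BruhatLE σ μ) : inv σ ≤ inv μ := by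
  rcases h.eq_or_inv_lt with rfl | h
  · exact le_rfl
  · exact h.le

theorem BruhatLE.antisymm {σ μ : Perm (Fin n)} (h : BruhatLE σ μ) (h' : BruhatLE μ σ) : σ = μ := by
  rcases h.eq_or_inv_lt with rfl | h
  · rfl
  · exact absurd h'.inv_le (not_le.2 h)

end Length

/-! ### The operators X and the Yang-Baxter relation -/

section Operators

variable {R : Type*} [CommRing R] {n : ℕ}

variable (R n) in
/-- The monoid of right operators on the free module on `K_σ`. -/
abbrev RightOp : Type _ := (Module.End R (KSpace R n))ᵐᵒᵖ

/-- The right action of an operator. -/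
noncomputable def act (f : KSpace R n) (m : RightOp R n) : KSpace R n := m.unop f

@[simp] theorem act_one (f : KSpace R n) : act f 1 = f := rfl

theorem act_mul (f : KSpace R n) (m m' : RightOp R n) : act f (m * m') = act (act f m) m' := by
  rw [act, MulOpposite.unop_mul, Module.End.mul_apply]; rfl

@[simp] theorem act_sub (f g : KSpace R n) (m : RightOp R n) :
    act (f - g) m = act f m - act g m := map_sub m.unop f g

@[simp] theorem act_zero (m : RightOp R n) : act 0 m = 0 := map_zero m.unop

theorem act_ite (p : Prop) [Decidable p] (f g : KSpace R n) (m : RightOp R n) :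
    act (if p then f else g) m = if p then act f m else act g m := by split_ifs <;> rfl

theorem rightOp_ext {m m' : RightOp R n} (h : ∀ σ, act (K R σ) m = act (K R σ) m') : m = m' := by
  apply MulOpposite.unop_injective
  apply Finsupp.lhom_ext
  intro σ r
  have h1 : (Finsupp.single σ r : KSpace R n) = r • K R σ := by simp [K]
  rw [h1, map_smul, map_smul]
  exact congrArg _ (h σ)

variable (R) in
/-- The operator `K_σ ↦ K_σ - K_{σ (a b)}` if `(a b)` is a Bruhat transposition for `σ`, and
`K_σ ↦ K_σ` otherwise. -/
noncomputable def X (a b : Fin n) : RightOp R n :=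
  MulOpposite.op (Finsupp.linearCombination R fun σ : Perm (Fin n) =>
    K R σ - if Cov σ a b then K R (σ * swap a b) else 0)

theorem act_X (σ : Perm (Fin n)) (a b : Fin n) :
    act (K R σ) (X R a b) = K R σ - if Cov σ a b then K R (σ * swap a b) else 0 := by
  simp only [act, X, MulOpposite.unop_op]
  exact (Finsupp.linearCombination_single R 1 σ).trans (one_smul R _)

variable (R) in
/-- The operator `π_i` as a right operator. -/
noncomputable def Pi (i : Fin (n - 1)) : RightOp R n := MulOpposite.op (piOp R i)

theorem act_Pi (σ : Perm (Fin n)) (i : Fin (n - 1)) :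
    act (K R σ) (Pi R i) = if σ (pos' i) < σ (pos i) then K R (σ * simple i) else K R σ := by
  simp only [act, Pi, MulOpposite.unop_op, piOp]
  exact (Finsupp.linearCombination_single R 1 σ).trans (one_smul R _)

/-- The only possible obstruction is a corner of one rectangle (positions by values) lying inside
the other. If the old point at a or b lay inside the rectangle of c, d while the exchanged points do
not, a corner of that rectangle would lie inside the one of a, b. -/
theorem Cov.comm_aux {σ : Perm (Fin n)} {a b c d : Fin n} (hac : a ≠ c) (had : a ≠ d) (hbc : b ≠ c)
    (hbd : b ≠ d) (h1 : Cov σ a b) (h2 : Cov (σ * swap a b) c d) :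
    Cov σ c d ∧ Cov (σ * swap c d) a b := by
  have ea : (σ * swap a b) a = σ b := by simp
  have eb : (σ * swap a b) b = σ a := by simp
  have ep : ∀ p, p ≠ a → p ≠ b → (σ * swap a b) p = σ p := fun p hp hp' => by
    rw [Perm.mul_apply, swap_apply_of_ne_of_ne hp hp']
  have fc : (σ * swap c d) c = σ d := by simp
  have fd : (σ * swap c d) d = σ c := by simp
  have fp : ∀ p, p ≠ c → p ≠ d → (σ * swap c d) p = σ p := fun p hp hp' => by
    rw [Perm.mul_apply, swap_apply_of_ne_of_ne hp hp']
  obtain ⟨hab, hv, hm⟩ := h1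
  obtain ⟨hcd, hv', hm'⟩ := h2
  have ma := hm' a
  have mb := hm' b
  have mc := hm c
  have md := hm d
  rw [ep c hac.symm hbc.symm, ep d had.symm hbd.symm] at hv'
  rw [ep c hac.symm hbc.symm, ep d had.symm hbd.symm, ea] at ma
  rw [ep c hac.symm hbc.symm, ep d had.symm hbd.symm, eb] at mb
  have hne1 : σ a ≠ σ c := fun h => hac (σ.injective h)
  have hne2 : σ a ≠ σ d := fun h => had (σ.injective h)
  have hne3 : σ b ≠ σ c := fun h => hbc (σ.injective h)
  have hne4 : σ b ≠ σ d := fun h => hbd (σ.injective h)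
  refine ⟨⟨hcd, hv', fun p h1 h2 h3 h4 => ?_⟩, hab, ?_, fun p h1 h2 h3 h4 => ?_⟩
  · by_cases hpa : p = a
    · subst hpa; grind
    by_cases hpb : p = b
    · subst hpb; grind
    have := hm' p h1 h2
    rw [ep c hac.symm hbc.symm, ep d had.symm hbd.symm, ep p hpa hpb] at this
    exact this h3 h4
  · rwa [fp a hac had, fp b hbc hbd]
  · rw [fp a hac had] at h3
    rw [fp b hbc hbd] at h4
    by_cases hpc : p = c
    · subst hpc
      rw [fc] at h3 h4
      grind
    by_cases hpd : p = d
    · subst hpd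
      rw [fd] at h3 h4
      grind
    rw [fp p hpc hpd] at h3 h4
    exact hm p h1 h2 h3 h4

theorem swap_mul_swap_comm {a b c d : Fin n} (hac : a ≠ c) (had : a ≠ d) (hbc : b ≠ c)
    (hbd : b ≠ d) : swap a b * swap c d = swap c d * swap a b := by
  apply Perm.Disjoint.commute
  intro x
  by_cases h : x = a ∨ x = b
  · right
    rcases h with rfl | rfl
    · exact swap_apply_of_ne_of_ne hac had
    · exact swap_apply_of_ne_of_ne hbc hbd
  · left
    rw [not_or] at h
    exact swap_apply_of_ne_of_ne h.1 h.2

theorem X_commute {a b c d : Fin n} (hac : a ≠ c) (had : a ≠ d) (hbc : b ≠ c)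
    (hbd : b ≠ d) : Commute (X R a b) (X R c d) := by
  apply rightOp_ext
  intro σ
  have hs : σ * swap c d * swap a b = σ * swap a b * swap c d := by
    rw [mul_assoc, mul_assoc, swap_mul_swap_comm hac had hbc hbd]
  have h1 : Cov σ a b ∧ Cov (σ * swap a b) c d ↔ Cov σ c d ∧ Cov (σ * swap c d) a b :=
    ⟨fun h => Cov.comm_aux hac had hbc hbd h.1 h.2,
      fun h => Cov.comm_aux hac.symm hbc.symm had.symm hbd.symm h.1 h.2⟩
  simp only [act_mul, act_X, act_sub, act_ite, act_zero, hs]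
  by_cases h2 : Cov σ a b <;> by_cases h3 : Cov σ c d <;>
    by_cases h4 : Cov (σ * swap a b) c d <;> by_cases h5 : Cov (σ * swap c d) a b <;>
    simp only [h2, h3, h4, h5, if_true, if_false] <;> first | abel1 | (exfalso; tauto)

/-- No position strictly between `a` and `b` carries a value strictly between `u` and `v`. -/
def NoMid (σ : Perm (Fin n)) (a b u v : Fin n) : Prop :=
  ∀ p, a < p → p < b → u < σ p → σ p < v → False

theorem cov_left_iff {σ τ : Perm (Fin n)} {a b c : Fin n} (hab : a < b) (hbc : b < c)
    (h : ∀ p, p ≠ a → p ≠ b → p ≠ c → τ p = σ p) :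
    Cov τ a b ↔ τ a < τ b ∧ NoMid σ a b (τ a) (τ b) := by
  simp only [Cov, NoMid, hab, true_and]
  refine and_congr_right fun _ => forall_congr' fun p => ?_
  refine forall_congr' fun h1 => forall_congr' fun h2 => ?_
  rw [h p h1.ne' h2.ne (h2.trans hbc).ne]

theorem cov_right_iff {σ τ : Perm (Fin n)} {a b c : Fin n} (hab : a < b) (hbc : b < c)
    (h : ∀ p, p ≠ a → p ≠ b → p ≠ c → τ p = σ p) :
    Cov τ b c ↔ τ b < τ c ∧ NoMid σ b c (τ b) (τ c) := by
  simp only [Cov, NoMid, hbc, true_and]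
  refine and_congr_right fun _ => forall_congr' fun p => ?_
  refine forall_congr' fun h1 => forall_congr' fun h2 => ?_
  rw [h p (hab.trans h1).ne' h1.ne' h2.ne]

theorem cov_outer_iff {σ τ : Perm (Fin n)} {a b c : Fin n} (hab : a < b) (hbc : b < c)
    (h : ∀ p, p ≠ a → p ≠ b → p ≠ c → τ p = σ p) :
    Cov τ a c ↔ τ a < τ c ∧ NoMid σ a b (τ a) (τ c) ∧ NoMid σ b c (τ a) (τ c) ∧
      ¬ (τ a < τ b ∧ τ b < τ c) := by
  constructor
  · rintro ⟨-, h1, h2⟩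
    refine ⟨h1, fun p h3 h4 => ?_, fun p h3 h4 => ?_, fun h3 => h2 b hab hbc h3.1 h3.2⟩
    · have := h2 p h3 (h4.trans hbc)
      rwa [h p h3.ne' h4.ne (h4.trans hbc).ne] at this
    · have := h2 p (hab.trans h3) h4
      rwa [h p (hab.trans h3).ne' h3.ne' h4.ne] at this
  · rintro ⟨h1, h2, h3, h4⟩
    refine ⟨hab.trans hbc, h1, fun p h5 h6 => ?_⟩
    rcases lt_trichotomy p b with h7 | rfl | h7
    · rw [h p h5.ne' h7.ne h6.ne]
      exact h2 p h5 h7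
    · tauto
    · rw [h p h5.ne' h7.ne' h6.ne]
      exact h3 p h7 h6

/-- The value of a position outside the range can be used as a cut: no position inside the range
carries it, so no candidate is lost at the cut. This reduces the conditions of the three-position
lemmas to propositional atoms. -/
theorem noMid_split {σ : Perm (Fin n)} {a b u w : Fin n} (q : Fin n) (hq : ¬ (a < q ∧ q < b))
    (huv : u < σ q) (hvw : σ q < w) :
    NoMid σ a b u w ↔ NoMid σ a b u (σ q) ∧ NoMid σ a b (σ q) w := by
  constructor
  · intro h
    exact ⟨fun p h1 h2 h3 h4 => h p h1 h2 h3 (h4.trans hvw),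
      fun p h1 h2 h3 h4 => h p h1 h2 (huv.trans h3) h4⟩
  · rintro ⟨h1, h2⟩ p h3 h4 h5 h6
    rcases lt_trichotomy (σ p) (σ q) with h7 | h7 | h7
    · exact h1 p h3 h4 h5 h7
    · exact hq (σ.injective h7 ▸ ⟨h3, h4⟩)
    · exact h2 p h3 h4 h7 h6

theorem noMid_adjacent {σ : Perm (Fin n)} {a b u w : Fin n} (h : b.val = a.val + 1) :
    NoMid σ a b u w := by
  intro p h1 h2
  rw [Fin.lt_def] at h1 h2
  omega

theorem cycle_eqs {a b c : Fin n} (hab : a ≠ b) (hbc : b ≠ c) (hac : a ≠ c) :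
    swap a c * swap a b = swap b c * swap a c ∧ swap a b * swap b c = swap b c * swap a c ∧
    swap b c * swap a b = swap a b * swap a c ∧ swap a c * swap b c = swap a b * swap a c := by
  refine ⟨?_, ?_, ?_, ?_⟩ <;> ext p <;> simp only [Perm.mul_apply, swap_apply_def] <;>
    split_ifs <;> simp_all

theorem ite_zero_add {A : Type*} [AddCommGroup A] {p q r : Prop} [Decidable p] [Decidable q]
    [Decidable r] (h : p ∨ q ↔ r) (h' : ¬ (p ∧ q)) (x : A) :
    (if p then x else 0) + (if q then x else 0) = if r then x else 0 := by
  by_cases hp : p <;> by_cases hq : q <;> by_cases hr : r <;> simp_all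

/-- The logical content of the Yang-Baxter relation. -/
theorem cov_yang_baxter (σ : Perm (Fin n)) {a b c : Fin n} (hab : a < b) (hbc : b < c) :
    ((Cov σ b c ∧ Cov (σ * swap b c) a c ∨ Cov σ a c ∧ Cov (σ * swap a c) a b ↔
      Cov σ a b ∧ Cov (σ * swap a b) b c) ∧
    ¬ ((Cov σ b c ∧ Cov (σ * swap b c) a c) ∧ Cov σ a c ∧ Cov (σ * swap a c) a b)) ∧
    ((Cov σ a b ∧ Cov (σ * swap a b) a c ∨ Cov σ a c ∧ Cov (σ * swap a c) b c ↔
      Cov σ b c ∧ Cov (σ * swap b c) a b) ∧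
    ¬ ((Cov σ a b ∧ Cov (σ * swap a b) a c) ∧ Cov σ a c ∧ Cov (σ * swap a c) b c)) ∧
    (Cov σ b c ∧ Cov (σ * swap b c) a c ∧ Cov (σ * swap b c * swap a c) a b ↔
      Cov σ a b ∧ Cov (σ * swap a b) a c ∧ Cov (σ * swap a b * swap a c) b c) := by
  have hac := hab.trans hbc
  have hout : ∀ p, p ≠ a → p ≠ b → p ≠ c → swap a b p = p ∧ swap a c p = p ∧ swap b c p = p :=
    fun p h1 h2 h3 => ⟨swap_apply_of_ne_of_ne h1 h2, swap_apply_of_ne_of_ne h1 h3,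
      swap_apply_of_ne_of_ne h2 h3⟩
  have k0 : ∀ p, p ≠ a → p ≠ b → p ≠ c → σ p = σ p := fun _ _ _ _ => rfl
  have k1 : ∀ p, p ≠ a → p ≠ b → p ≠ c → (σ * swap a b) p = σ p :=
    fun p h1 h2 h3 => by simp [hout p h1 h2 h3]
  have k2 : ∀ p, p ≠ a → p ≠ b → p ≠ c → (σ * swap a c) p = σ p :=
    fun p h1 h2 h3 => by simp [hout p h1 h2 h3]
  have k3 : ∀ p, p ≠ a → p ≠ b → p ≠ c → (σ * swap b c) p = σ p :=
    fun p h1 h2 h3 => by simp [hout p h1 h2 h3]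
  have k4 : ∀ p, p ≠ a → p ≠ b → p ≠ c → (σ * swap b c * swap a c) p = σ p :=
    fun p h1 h2 h3 => by simp [hout p h1 h2 h3]
  have k5 : ∀ p, p ≠ a → p ≠ b → p ≠ c → (σ * swap a b * swap a c) p = σ p :=
    fun p h1 h2 h3 => by simp [hout p h1 h2 h3]
  have v1 : swap a b c = c := swap_apply_of_ne_of_ne hac.ne' hbc.ne'
  have v2 : swap a c b = b := swap_apply_of_ne_of_ne hab.ne' hbc.ne
  have v3 : swap b c a = a := swap_apply_of_ne_of_ne hab.ne hac.ne
  rw [cov_left_iff hab hbc k0, cov_left_iff hab hbc k2, cov_left_iff hab hbc k3,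
    cov_left_iff hab hbc k4, cov_right_iff hab hbc k0, cov_right_iff hab hbc k1,
    cov_right_iff hab hbc k2, cov_right_iff hab hbc k5, cov_outer_iff hab hbc k0,
    cov_outer_iff hab hbc k1, cov_outer_iff hab hbc k3]
  simp only [Perm.mul_apply, swap_apply_left, swap_apply_right, v1, v2, v3]
  have hqa1 : ¬ (a < a ∧ a < b) := by simp
  have hqa2 : ¬ (b < a ∧ a < c) := by simp [hab.le]
  have hqb1 : ¬ (a < b ∧ b < b) := by simp
  have hqb2 : ¬ (b < b ∧ b < c) := by simp
  have hqc1 : ¬ (a < c ∧ c < b) := by simp [hbc.le]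
  have hqc2 : ¬ (b < c ∧ c < c) := by simp
  have n1 : σ a ≠ σ b := fun h => hab.ne (σ.injective h)
  have n2 : σ b ≠ σ c := fun h => hbc.ne (σ.injective h)
  have n3 : σ a ≠ σ c := fun h => hac.ne (σ.injective h)
  clear k0 k1 k2 k3 k4 k5 v1 v2 v3 hout
  -- Six of the eight sign patterns are orders of the three values. In each one, emptiness of a long
  -- value range splits at the middle value if needed, and the claim becomes a tautology.
  rcases lt_or_gt_of_ne n1 with h1 | h1 <;> rcases lt_or_gt_of_ne n2 with h2 | h2 <;>
    rcases lt_or_gt_of_ne n3 with h3 | h3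
  · simp only [noMid_split b hqb1 h1 h2, noMid_split b hqb2 h1 h2,
      h1, h2, h3, not_lt_of_gt h1, not_lt_of_gt h2]
    clear * -
    tauto
  · exact absurd (h1.trans h2) (not_lt_of_gt h3)
  · simp only [noMid_split c hqc1 h3 h2, noMid_split c hqc2 h3 h2,
      h1, h2, h3, not_lt_of_gt h1, not_lt_of_gt h2]
    clear * -
    tauto
  · simp only [noMid_split a hqa1 h3 h1,
      h1, h2, not_lt_of_gt h1, not_lt_of_gt h2, not_lt_of_gt h3]
    clear * -
    tauto
  · simp only [noMid_split a hqa1 h1 h3, noMid_split a hqa2 h1 h3,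
      h1, h2, h3, not_lt_of_gt h1, not_lt_of_gt h2]
    clear * -
    tauto
  · simp only [noMid_split c hqc2 h2 h3,
      h1, h2, not_lt_of_gt h1, not_lt_of_gt h2, not_lt_of_gt h3]
    clear * -
    tauto
  · exact absurd (h3.trans h2) (not_lt_of_gt h1)
  · simp only [h1, h2, not_lt_of_gt h1, not_lt_of_gt h2, not_lt_of_gt h3]
    clear * -
    tauto

theorem X_yang_baxter {a b c : Fin n} (hab : a < b) (hbc : b < c) :
    X R b c * X R a c * X R a b = X R a b * X R a c * X R b c := by
  apply rightOp_ext
  intro σ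
  have hac := hab.trans hbc
  obtain ⟨e1, e2, e3, e4⟩ := cycle_eqs hab.ne hbc.ne hac.ne
  have f1 : σ * swap a c * swap a b = σ * swap b c * swap a c := by rw [mul_assoc, e1, mul_assoc]
  have f2 : σ * swap a b * swap b c = σ * swap b c * swap a c := by rw [mul_assoc, e2, mul_assoc]
  have f3 : σ * swap b c * swap a b = σ * swap a b * swap a c := by rw [mul_assoc, e3, mul_assoc]
  have f4 : σ * swap a c * swap b c = σ * swap a b * swap a c := by rw [mul_assoc, e4, mul_assoc]
  have f5 : σ * swap b c * swap a c * swap a b = σ * swap a c := by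
    rw [← f1, mul_assoc, swap_mul_self, mul_one]
  have f6 : σ * swap a b * swap a c * swap b c = σ * swap a c := by
    rw [← f4, mul_assoc, swap_mul_self, mul_one]
  have ite_sub_zero : ∀ (p : Prop) [Decidable p] (f g : KSpace R n),
      (if p then f - g else 0) = (if p then f else 0) - if p then g else 0 := by
    intro p _ f g; split_ifs <;> simp
  obtain ⟨⟨h1, h2⟩, ⟨h3, h4⟩, h5⟩ := cov_yang_baxter σ hab hbc
  -- Two-step paths end at one of two 3-cycles. For each of them, two mutually exclusive paths on
  -- one side of the relation match a single path on the other.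
  have t1 := ite_zero_add h1 h2 (K R (σ * swap b c * swap a c))
  have t2 := ite_zero_add h3 h4 (K R (σ * swap a b * swap a c))
  simp only [act_mul, act_X, act_sub, act_ite, act_zero, f1, f2, f3, f4, f5, f6, ite_sub_zero,
    ← ite_and, ← t1, ← t2, and_assoc, h5]
  abel

end Operators

/-! ### Commutation of π_i with products of the X -/

section Commutation

variable {R : Type*} [CommRing R] {n : ℕ}

/-- Exchanging two adjacent positions, neither of which is a or b, moves no point across a or across
b. -/
theorem Cov.mul_simple {σ : Perm (Fin n)} {i : Fin (n - 1)} {a b : Fin n} (h1 : a ≠ pos i)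
    (h2 : a ≠ pos' i) (h3 : b ≠ pos i) (h4 : b ≠ pos' i) (h : Cov σ a b) :
    Cov (σ * simple i) a b := by
  have ea : (σ * simple i) a = σ a := by
    rw [Perm.mul_apply, simple_eq, swap_apply_of_ne_of_ne h1 h2]
  have eb : (σ * simple i) b = σ b := by
    rw [Perm.mul_apply, simple_eq, swap_apply_of_ne_of_ne h3 h4]
  refine ⟨h.1, by rw [ea, eb]; exact h.2.1, fun p hp hp' => ?_⟩
  rw [ea, eb, Perm.mul_apply]
  have h1' : a.val ≠ i.val := fun h => h1 (Fin.ext h)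
  have h2' : a.val ≠ i.val + 1 := fun h => h2 (Fin.ext h)
  have h3' : b.val ≠ i.val := fun h => h3 (Fin.ext h)
  have h4' : b.val ≠ i.val + 1 := fun h => h4 (Fin.ext h)
  apply h.2.2 (simple i p) <;>
  · simp only [simple_eq, swap_apply_def]
    split_ifs with h5 h6
    · subst h5; simp only [Fin.lt_def] at *; omega
    · subst h6; simp only [Fin.lt_def] at *; omega
    · assumption

theorem cov_mul_simple_iff {σ : Perm (Fin n)} {i : Fin (n - 1)} {a b : Fin n} (h1 : a ≠ pos i)
    (h2 : a ≠ pos' i) (h3 : b ≠ pos i) (h4 : b ≠ pos' i) :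
    Cov (σ * simple i) a b ↔ Cov σ a b :=
  ⟨fun h => by simpa using h.mul_simple h1 h2 h3 h4, fun h => h.mul_simple h1 h2 h3 h4⟩

theorem Pi_commute_X {i : Fin (n - 1)} {a b : Fin n} (h1 : a ≠ pos i)
    (h2 : a ≠ pos' i) (h3 : b ≠ pos i) (h4 : b ≠ pos' i) :
    Commute (Pi R i) (X R a b) := by
  apply rightOp_ext
  intro σ
  have hs : σ * swap a b * simple i = σ * simple i * swap a b := by
    rw [mul_assoc, mul_assoc, simple_eq, swap_mul_swap_comm h1 h2 h3 h4]
  have e1 : (σ * swap a b) (pos i) = σ (pos i) := by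
    rw [Perm.mul_apply, swap_apply_of_ne_of_ne h1.symm h3.symm]
  have e2 : (σ * swap a b) (pos' i) = σ (pos' i) := by
    rw [Perm.mul_apply, swap_apply_of_ne_of_ne h2.symm h4.symm]
  simp only [act_mul, act_X, act_Pi, act_sub, act_ite, act_zero, hs, e1, e2,
    cov_mul_simple_iff h1 h2 h3 h4]
  split_ifs <;> rfl

/-- Neither factor commutes with π_i alone in general, but the pair of factors sharing c does. The
operator enters through its action on the basis, so that the positions can stay variables. -/
theorem commute_mul_of_lt {a b c : Fin n} {P : RightOp R n} (hb : b.val = a.val + 1) (hbc : b < c)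
    (hP : ∀ σ, act (K R σ) P = if σ b < σ a then K R (σ * swap a b) else K R σ) :
    Commute P (X R a c * X R b c) := by
  classical
  apply rightOp_ext
  intro σ
  have hab : a < b := by rw [Fin.lt_def]; omega
  have hac := hab.trans hbc
  obtain ⟨e1, e2, e3, e4⟩ := cycle_eqs hab.ne hbc.ne hac.ne
  have f1 : σ * swap a c * swap a b = σ * swap b c * swap a c := by rw [mul_assoc, e1, mul_assoc]
  have f2 : σ * swap a b * swap b c = σ * swap b c * swap a c := by rw [mul_assoc, e2, mul_assoc]
  have f3 : σ * swap b c * swap a b = σ * swap a b * swap a c := by rw [mul_assoc, e3, mul_assoc]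
  have f4 : σ * swap a c * swap b c = σ * swap a b * swap a c := by rw [mul_assoc, e4, mul_assoc]
  have f6 : σ * swap a b * swap a c * swap b c = σ * swap a c := by
    rw [← f4, mul_assoc, swap_mul_self, mul_one]
  have f7 : σ * swap a b * swap a c * swap a b = σ * swap b c := by
    rw [← f3, mul_assoc, swap_mul_self, mul_one]
  have hout : ∀ p, p ≠ a → p ≠ b → p ≠ c → swap a b p = p ∧ swap a c p = p ∧ swap b c p = p :=
    fun p h1 h2 h3 => ⟨swap_apply_of_ne_of_ne h1 h2, swap_apply_of_ne_of_ne h1 h3,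
      swap_apply_of_ne_of_ne h2 h3⟩
  have k0 : ∀ p, p ≠ a → p ≠ b → p ≠ c → σ p = σ p := fun _ _ _ _ => rfl
  have k1 : ∀ p, p ≠ a → p ≠ b → p ≠ c → (σ * swap a b) p = σ p :=
    fun p h1 h2 h3 => by simp [hout p h1 h2 h3]
  have k2 : ∀ p, p ≠ a → p ≠ b → p ≠ c → (σ * swap a c) p = σ p :=
    fun p h1 h2 h3 => by simp [hout p h1 h2 h3]
  have k5 : ∀ p, p ≠ a → p ≠ b → p ≠ c → (σ * swap a b * swap a c) p = σ p :=
    fun p h1 h2 h3 => by simp [hout p h1 h2 h3]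
  have v1 : swap a b c = c := swap_apply_of_ne_of_ne hac.ne' hbc.ne'
  have v2 : swap a c b = b := swap_apply_of_ne_of_ne hab.ne' hbc.ne
  have v3 : swap b c a = a := swap_apply_of_ne_of_ne hab.ne hac.ne
  have hnm : ∀ u w, NoMid σ a b u w := fun u w => noMid_adjacent hb
  simp only [act_mul, act_X, hP, act_sub, act_ite, act_zero, f1, f2, f3, f4, f6, f7]
  simp only [cov_right_iff hab hbc k0, cov_right_iff hab hbc k1,
    cov_right_iff hab hbc k2, cov_right_iff hab hbc k5, cov_outer_iff hab hbc k0,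
    cov_outer_iff hab hbc k1, hnm, Perm.mul_apply, swap_apply_left, swap_apply_right, v1, v2, v3]
  have hqa : ¬ (b < a ∧ a < c) := by simp [hab.le]
  have n1 : σ a ≠ σ b := fun h => hab.ne (σ.injective h)
  have n2 : σ b ≠ σ c := fun h => hbc.ne (σ.injective h)
  have n3 : σ a ≠ σ c := fun h => hac.ne (σ.injective h)
  clear k0 k1 k2 k5 e1 e2 e3 e4 f1 f2 f3 f4 f6 f7 v1 v2 v3 hout hnm hP
  rcases lt_or_gt_of_ne n1 with h1 | h1 <;> rcases lt_or_gt_of_ne n2 with h2 | h2 <;>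
    rcases lt_or_gt_of_ne n3 with h3 | h3 <;>
    simp only [h1, h2, h3, not_lt_of_gt h1, not_lt_of_gt h2, not_lt_of_gt h3, true_and, false_and,
      and_false, if_false, if_true, not_true_eq_false, not_false_eq_true, and_true, sub_zero]
  · exact absurd (h1.trans h2) (not_lt_of_gt h3)
  -- The order left over is σ b < σ a < σ c, where the values between σ b and σ c have to be split
  -- at σ a.
  · simp only [noMid_split a hqa h1 h3]
    by_cases q1 : NoMid σ b c (σ b) (σ a) <;> by_cases q2 : NoMid σ b c (σ a) (σ c) <;>
      simp only [q1, q2, and_true, and_false, if_true, if_false, sub_zero] <;> abel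
  · exact absurd (h3.trans h2) (not_lt_of_gt h1)

theorem commute_mul_of_gt {a b c : Fin n} {P : RightOp R n} (hab : a < b) (hc : c.val = b.val + 1)
    (hP : ∀ σ, act (K R σ) P = if σ c < σ b then K R (σ * swap b c) else K R σ) :
    Commute P (X R a c * X R a b) := by
  classical
  apply rightOp_ext
  intro σ
  have hbc : b < c := by rw [Fin.lt_def]; omega
  have hac := hab.trans hbc
  obtain ⟨e1, e2, e3, e4⟩ := cycle_eqs hab.ne hbc.ne hac.ne
  have f1 : σ * swap a c * swap a b = σ * swap b c * swap a c := by rw [mul_assoc, e1, mul_assoc]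
  have f2 : σ * swap a b * swap b c = σ * swap b c * swap a c := by rw [mul_assoc, e2, mul_assoc]
  have f3 : σ * swap b c * swap a b = σ * swap a b * swap a c := by rw [mul_assoc, e3, mul_assoc]
  have f4 : σ * swap a c * swap b c = σ * swap a b * swap a c := by rw [mul_assoc, e4, mul_assoc]
  have f6 : σ * swap b c * swap a c * swap a b = σ * swap a c := by
    rw [← f1, mul_assoc, swap_mul_self, mul_one]
  have f7 : σ * swap b c * swap a c * swap b c = σ * swap a b := by
    rw [← f2, mul_assoc, swap_mul_self, mul_one]
  have hout : ∀ p, p ≠ a → p ≠ b → p ≠ c → swap a b p = p ∧ swap a c p = p ∧ swap b c p = p :=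
    fun p h1 h2 h3 => ⟨swap_apply_of_ne_of_ne h1 h2, swap_apply_of_ne_of_ne h1 h3,
      swap_apply_of_ne_of_ne h2 h3⟩
  have k0 : ∀ p, p ≠ a → p ≠ b → p ≠ c → σ p = σ p := fun _ _ _ _ => rfl
  have k1 : ∀ p, p ≠ a → p ≠ b → p ≠ c → (σ * swap b c) p = σ p :=
    fun p h1 h2 h3 => by simp [hout p h1 h2 h3]
  have k2 : ∀ p, p ≠ a → p ≠ b → p ≠ c → (σ * swap a c) p = σ p :=
    fun p h1 h2 h3 => by simp [hout p h1 h2 h3]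
  have k5 : ∀ p, p ≠ a → p ≠ b → p ≠ c → (σ * swap b c * swap a c) p = σ p :=
    fun p h1 h2 h3 => by simp [hout p h1 h2 h3]
  have v1 : swap a b c = c := swap_apply_of_ne_of_ne hac.ne' hbc.ne'
  have v2 : swap a c b = b := swap_apply_of_ne_of_ne hab.ne' hbc.ne
  have v3 : swap b c a = a := swap_apply_of_ne_of_ne hab.ne hac.ne
  have hnm : ∀ u w, NoMid σ b c u w := fun u w => noMid_adjacent hc
  simp only [act_mul, act_X, hP, act_sub, act_ite, act_zero, f1, f2, f3, f4, f6, f7]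
  simp only [cov_left_iff hab hbc k0, cov_left_iff hab hbc k1,
    cov_left_iff hab hbc k2, cov_left_iff hab hbc k5, cov_outer_iff hab hbc k0,
    cov_outer_iff hab hbc k1, hnm, Perm.mul_apply, swap_apply_left, swap_apply_right, v1, v2, v3]
  have hqc : ¬ (a < c ∧ c < b) := by simp [hbc.le]
  have n1 : σ a ≠ σ b := fun h => hab.ne (σ.injective h)
  have n2 : σ b ≠ σ c := fun h => hbc.ne (σ.injective h)
  have n3 : σ a ≠ σ c := fun h => hac.ne (σ.injective h)
  clear k0 k1 k2 k5 e1 e2 e3 e4 f1 f2 f3 f4 f6 f7 v1 v2 v3 hout hnm hP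
  rcases lt_or_gt_of_ne n1 with h1 | h1 <;> rcases lt_or_gt_of_ne n2 with h2 | h2 <;>
    rcases lt_or_gt_of_ne n3 with h3 | h3 <;>
    simp only [h1, h2, h3, not_lt_of_gt h1, not_lt_of_gt h2, not_lt_of_gt h3, true_and, false_and,
      and_false, if_false, if_true, not_true_eq_false, not_false_eq_true, and_true, sub_zero]
  · exact absurd (h1.trans h2) (not_lt_of_gt h3)
  -- The order left over is σ a < σ c < σ b, where the values between σ a and σ b have to be split
  -- at σ c.
  · simp only [noMid_split c hqc h3 h2]
    by_cases q1 : NoMid σ a b (σ a) (σ c) <;> by_cases q2 : NoMid σ a b (σ c) (σ b) <;>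
      simp only [q1, q2, and_true, and_false, if_true, if_false, sub_zero] <;> abel
  · exact absurd (h3.trans h2) (not_lt_of_gt h1)

end Commutation

/-! ### Reordering products in a monoid with a Yang-Baxter relation -/

section Products

variable {M : Type*} [Monoid M] (x : ℕ → ℕ → M)

/-- The product `x a (l + d - 1) ⋯ x a l`. -/
def row (a l : ℕ) : ℕ → M
  | 0 => 1
  | d + 1 => x a (l + d) * row a l d

/-- The product of `row p l d, …, row (p + j - 1) l d`. -/
def blk (p l d : ℕ) : ℕ → M
  | 0 => 1
  | j + 1 => blk p l d j * row x (p + j) l d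

/-- The product of the rows `x a (N - 1) ⋯ x a (a + 1)` for `a = q - 1, …, 0`. -/
def full (N : ℕ) : ℕ → M
  | 0 => 1
  | q + 1 => row x q (q + 1) (N - 1 - q) * full N q

variable {x}

theorem row_append (a l d e : ℕ) : row x a l (d + e) = row x a (l + d) e * row x a l d := by
  induction e with
  | zero => simp [row]
  | succ e ih => rw [← add_assoc, row, row, ih, mul_assoc, add_assoc]

theorem blk_append (p l d j e : ℕ) :
    blk x p l d (j + e) = blk x p l d j * blk x (p + j) l d e := by
  induction e with
  | zero => simp [blk]
  | succ e ih => rw [← add_assoc, blk, blk, ih, mul_assoc, add_assoc]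

theorem blk_cons (p l d j : ℕ) : blk x p l d (j + 1) = row x p l d * blk x (p + 1) l d j := by
  rw [add_comm, blk_append]; simp [blk]

theorem commute_row {y : M} {a l d : ℕ} (h : ∀ b, l ≤ b → b < l + d → Commute y (x a b)) :
    Commute y (row x a l d) := by
  induction d with
  | zero => exact Commute.one_right _
  | succ d ih =>
    exact (h _ (by omega) (by omega)).mul_right (ih fun b h1 h2 => h b h1 (by omega))

theorem commute_blk {y : M} {p l d j : ℕ} (h : ∀ a, p ≤ a → a < p + j → Commute y (row x a l d)) :
    Commute y (blk x p l d j) := by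
  induction j with
  | zero => exact Commute.one_right _
  | succ j ih =>
    exact (ih fun a h1 h2 => h a h1 (by omega)).mul_right (h _ (by omega) (by omega))

theorem commute_full {y : M} {N q : ℕ}
    (h : ∀ a, a < q → Commute y (row x a (a + 1) (N - 1 - a))) : Commute y (full x N q) := by
  induction q with
  | zero => exact Commute.one_right _
  | succ q ih => exact (h q (by omega)).mul_right (ih fun a ha => h a (by omega))

theorem blk_zero (p l j : ℕ) : blk x p l 0 j = 1 := by
  induction j with
  | zero => rfl
  | succ j ih => rw [blk, ih, row, mul_one]

variable (x) in
/-- Operators attached to disjoint pairs commute, and the Yang-Baxter relation holds. -/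
structure IsYangBaxter : Prop where
  comm : ∀ {a b c d : ℕ}, a ≠ c → a ≠ d → b ≠ c → b ≠ d → Commute (x a b) (x c d)
  braid : ∀ {a b c : ℕ}, a < b → b < c → x b c * x a c * x a b = x a b * x a c * x b c

variable (hx : IsYangBaxter x)
include hx

/-- The factor x a a' is carried through the two rows one column at a time. Each column is one braid
relation, and entries in different rows and different columns commute. -/
theorem IsYangBaxter.row_mul_row {a a' l : ℕ} (h : a < a') (hl : a' < l) (d : ℕ) :
    row x a' l d * row x a l d * x a a' = x a a' * row x a l d * row x a' l d := by
  induction d with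
  | zero => simp [row]
  | succ d ih =>
    have c1 : Commute (x a (l + d)) (row x a' l d) := commute_row fun b h1 h2 =>
      hx.comm (by omega) (by omega) (by omega) (by omega)
    have c2 : Commute (x a' (l + d)) (row x a l d) := commute_row fun b h1 h2 =>
      hx.comm (by omega) (by omega) (by omega) (by omega)
    calc x a' (l + d) * row x a' l d * (x a (l + d) * row x a l d) * x a a'
        = x a' (l + d) * (row x a' l d * x a (l + d)) * row x a l d * x a a' := by
          simp only [mul_assoc]
      _ = x a' (l + d) * x a (l + d) * (row x a' l d * row x a l d * x a a') := by
          rw [← c1.eq]; simp only [mul_assoc]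
      _ = x a' (l + d) * x a (l + d) * x a a' * (row x a l d * row x a' l d) := by
          rw [ih]; simp only [mul_assoc]
      _ = x a a' * x a (l + d) * (x a' (l + d) * row x a l d) * row x a' l d := by
          rw [hx.braid h (by omega)]; simp only [mul_assoc]
      _ = x a a' * (x a (l + d) * row x a l d) * (x a' (l + d) * row x a' l d) := by
          rw [c2.eq]; simp only [mul_assoc]

/-- Each factor x a a' of the short row passes through the rows a and a' by `row_mul_row` and
commutes with everything else; its effect is to move row a from the bottom of the rectangle to the
top. -/
theorem IsYangBaxter.blk_mul_row {a l : ℕ} (d j : ℕ) (hl : a + j < l) :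
    blk x (a + 1) l d j * row x a l d * row x a (a + 1) j =
      row x a (a + 1) j * (row x a l d * blk x (a + 1) l d j) := by
  induction j with
  | zero => simp [row, blk]
  | succ j ih =>
    have c1 : Commute (x a (a + 1 + j)) (blk x (a + 1) l d j) := commute_blk fun a' h1 h2 =>
      commute_row fun b h3 h4 => hx.comm (by omega) (by omega) (by omega) (by omega)
    have c2 : Commute (row x (a + 1 + j) l d) (row x a (a + 1) j) := commute_row fun b h1 h2 =>
      (commute_row fun b' h3 h4 => hx.comm (by omega) (by omega) (by omega) (by omega)).symm
    calc blk x (a + 1) l d j * row x (a + 1 + j) l d * row x a l d *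
          (x a (a + 1 + j) * row x a (a + 1) j)
        = blk x (a + 1) l d j * (row x (a + 1 + j) l d * row x a l d * x a (a + 1 + j)) *
          row x a (a + 1) j := by simp only [mul_assoc]
      _ = (blk x (a + 1) l d j * x a (a + 1 + j)) * row x a l d * (row x (a + 1 + j) l d *
          row x a (a + 1) j) := by
          rw [hx.row_mul_row (by omega) (by omega)]; simp only [mul_assoc]
      _ = x a (a + 1 + j) * (blk x (a + 1) l d j * row x a l d * row x a (a + 1) j) *
          row x (a + 1 + j) l d := by
          rw [c2.eq, ← c1.eq]; simp only [mul_assoc]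
      _ = x a (a + 1 + j) * row x a (a + 1) j * (row x a l d *
          (blk x (a + 1) l d j * row x (a + 1 + j) l d)) := by
          rw [ih (by omega)]; simp only [mul_assoc]

/-- Row p splits into its columns from q on and its columns below q. The first part joins the
rectangle, and the second moves left past the rectangle into I. -/
theorem IsYangBaxter.full_eq {N p q : ℕ} (hpq : p ≤ q) (hqN : q ≤ N) :
    ∃ I ∈ Submonoid.closure {y | ∃ a b, p ≤ a ∧ a < b ∧ b < q ∧ y = x a b},
      full x N q = I * blk x p q (N - q) (q - p) * full x N p := by
  obtain ⟨j, rfl⟩ := Nat.exists_eq_add_of_le hpq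
  clear hpq
  induction j generalizing p with
  | zero => exact ⟨1, one_mem _, by simp [blk]⟩
  | succ j ih =>
    obtain ⟨I, hI, h⟩ := ih (p := p + 1) (by omega)
    refine ⟨I * row x p (p + 1) j, mul_mem (Submonoid.closure_mono ?_ hI) ?_, ?_⟩
    · rintro _ ⟨a, b, h1, h2, h3, rfl⟩
      exact ⟨a, b, by omega, h2, by omega, rfl⟩
    · have : ∀ d ≤ j, row x p (p + 1) d ∈ Submonoid.closure
          {y | ∃ a b, p ≤ a ∧ a < b ∧ b < p + (j + 1) ∧ y = x a b} := by
        intro d hd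
        induction d with
        | zero => exact one_mem _
        | succ d ihd =>
          exact mul_mem (Submonoid.subset_closure ⟨p, p + 1 + d, le_rfl, by omega, by omega, rfl⟩)
            (ihd (by omega))
      exact this j le_rfl
    · have e1 : p + (j + 1) = p + 1 + j := by omega
      have e2 : N - 1 - p = j + (N - (p + 1 + j)) := by omega
      rw [e1, h, full, e2, row_append, Nat.add_sub_cancel_left,
        show p + 1 + j - p = j + 1 by omega, blk_cons]
      have := hx.blk_mul_row (a := p) (l := p + 1 + j) (N - (p + 1 + j)) j (by omega)
      calc I * blk x (p + 1) (p + 1 + j) (N - (p + 1 + j)) j *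
            (row x p (p + 1 + j) (N - (p + 1 + j)) * row x p (p + 1) j * full x N p)
          = I * (blk x (p + 1) (p + 1 + j) (N - (p + 1 + j)) j *
            row x p (p + 1 + j) (N - (p + 1 + j)) * row x p (p + 1) j) * full x N p := by
            simp only [mul_assoc]
        _ = _ := by rw [this]; simp only [mul_assoc]

/-- The last cut, or `0` if there is none. -/
def lastCut : {m : ℕ} → (Fin m → ℕ) → ℕ
  | 0, _ => 0
  | m + 1, k => k (Fin.last m)

end Products

/-! ### Products along lists -/

section Lists

theorem row_eq_prod {M : Type*} [Monoid M] (x : ℕ → ℕ → M) (a l d : ℕ) :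
    row x a l d = ((List.range' l d).reverse.map (x a)).prod := by
  induction d with
  | zero => rfl
  | succ d ih => simp [row, ih, List.range'_concat]

theorem blk_eq_prod {M : Type*} [Monoid M] (x : ℕ → ℕ → M) (p l d j : ℕ) :
    blk x p l d j = ((List.range' p j).map fun a => row x a l d).prod := by
  induction j with
  | zero => rfl
  | succ d ih => simp [blk, ih, List.range'_concat]

theorem range_filter_eq_range' {n l j : ℕ} (h : l + j ≤ n) :
    (List.range n).filter (fun a => l ≤ a ∧ a < l + j) = List.range' l j := by
  have e : List.range n = List.range' 0 l ++ (List.range' l j ++ List.range' (l + j) (n - (l + j))) := by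
    have h1 := List.range'_append_1 (s := l) (m := j) (n := n - (l + j))
    have h2 := List.range'_append_1 (s := 0) (m := l) (n := n - l)
    rw [zero_add] at h2
    rw [h1, show j + (n - (l + j)) = n - l by omega, h2, List.range_eq_range']
    congr 1
    omega
  rw [e, List.filter_append, List.filter_append, List.filter_eq_nil_iff.2, List.filter_eq_self.2,
    List.filter_eq_nil_iff.2, List.nil_append, List.append_nil]
  · intro a ha; simp at ha ⊢; omega
  · intro a ha; simp at ha ⊢; omega
  · intro a ha; simp at ha ⊢; omega

theorem finRange_filter_map_val {n l j : ℕ} (h : l + j ≤ n) :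
    ((List.finRange n).filter fun a => l ≤ a.val ∧ a.val < l + j).map Fin.val =
      List.range' l j := by
  rw [← range_filter_eq_range' h, ← List.map_coe_finRange_eq_range, List.filter_map]
  rfl

theorem prod_map_flatMap {α β M : Type*} [Monoid M] (L : List α) (f : α → List β) (g : β → M) :
    ((L.flatMap f).map g).prod = (L.map fun a => ((f a).map g).prod).prod := by
  induction L with
  | nil => rfl
  | cons a L ih => simp [ih]

end Lists

/-! ### The full product and its factorization along the cuts -/

section CutOperator

variable {R : Type*} [CommRing R] {n : ℕ}

variable (R n) in
/-- The operators `X a b`, extended by `1` to pairs of natural numbers. -/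
noncomputable def natX (a b : ℕ) : RightOp R n :=
  if h : a < n ∧ b < n then X R ⟨a, h.1⟩ ⟨b, h.2⟩ else 1

theorem natX_val (a b : Fin n) : natX R n a b = X R a b := by
  simp [natX]

theorem natX_yangBaxter : IsYangBaxter (natX R n) where
  comm {a b c d} h1 h2 h3 h4 := by
    unfold natX
    split_ifs
    · apply X_commute <;> simpa [Fin.ext_iff]
    · exact Commute.one_right _
    · exact Commute.one_left _
    · exact Commute.one_left _
  braid {a b c} h1 h2 := by
    by_cases hc : c < n
    · simp only [natX, hc, h1.trans (h2.trans hc), h2.trans hc, and_self, dif_pos]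
      exact X_yang_baxter h1 h2
    · simp [natX, hc]

theorem Pi_commute_natX {i : Fin (n - 1)} {a b : ℕ} (h1 : a ≠ i) (h2 : a ≠ i + 1) (h3 : b ≠ i)
    (h4 : b ≠ i + 1) : Commute (Pi R i) (natX R n a b) := by
  unfold natX
  split_ifs
  · apply Pi_commute_X <;> simpa [Fin.ext_iff]
  · exact Commute.one_right _

theorem Pi_commute_natX_right {i : Fin (n - 1)} {c : ℕ} (h : i + 1 < c) :
    Commute (Pi R i) (natX R n i c * natX R n (i + 1) c) := by
  by_cases hc : c < n
  · have h1 : i.val < n := by omega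
    have h2 : i.val + 1 < n := by omega
    simp only [natX, hc, h1, h2, and_self, dif_pos]
    exact commute_mul_of_lt rfl h (fun σ => act_Pi σ i)
  · simp [natX, hc]

theorem Pi_commute_natX_left {i : Fin (n - 1)} {c : ℕ} (h : c < i) :
    Commute (Pi R i) (natX R n c (i + 1) * natX R n c i) := by
  have h1 : i.val < n := by omega
  have h2 : i.val + 1 < n := by omega
  simp only [natX, h.trans h1, h1, h2, and_self, dif_pos]
  exact commute_mul_of_gt h rfl (fun σ => act_Pi σ i)

/-- The columns i + 1 and i are adjacent factors of the row; together they commute with π_i, and all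
other factors are disjoint from i and i + 1. -/
theorem Pi_commute_row {i : Fin (n - 1)} {a l d : ℕ} (ha : a < i)
    (hl : l ≤ i) (hd : i + 1 < l + d) : Commute (Pi R i) (row (natX R n) a l d) := by
  obtain ⟨e, he⟩ := Nat.exists_eq_add_of_le hl
  obtain ⟨f, rfl⟩ : ∃ f, d = e + 2 + f := ⟨d - e - 2, by omega⟩
  rw [row_append, row_append]
  refine (commute_row fun b h1 h2 => Pi_commute_natX ?_ ?_ ?_ ?_).mul_right
    (Commute.mul_right ?_ (commute_row fun b h1 h2 => Pi_commute_natX ?_ ?_ ?_ ?_)) <;>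
    try omega
  have := Pi_commute_natX_left (R := R) ha
  rw [he] at this
  simp only [row, mul_one]
  exact this

/-- The two rows can be interleaved into the products X_{i,c} X_{i+1,c}, each of which commutes with
π_i. -/
theorem Pi_commute_row_mul_row {i : Fin (n - 1)} {l : ℕ} (hl : i + 1 < l) (d : ℕ) :
    Commute (Pi R i) (row (natX R n) i l d * row (natX R n) (i + 1) l d) := by
  induction d with
  | zero => simp [row]
  | succ d ih =>
    have c : Commute (natX R n (i + 1) (l + d)) (row (natX R n) i l d) :=
      commute_row fun b h1 h2 =>
        natX_yangBaxter.comm (by omega) (by omega) (by omega) (by omega)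
    have e : row (natX R n) i l (d + 1) * row (natX R n) (i + 1) l (d + 1) =
        (natX R n i (l + d) * natX R n (i + 1) (l + d)) *
        (row (natX R n) i l d * row (natX R n) (i + 1) l d) := by
      simp only [row]
      rw [mul_assoc, ← mul_assoc (row _ _ _ _), ← c.eq]
      simp only [mul_assoc]
    rw [e]
    exact (Pi_commute_natX_right (by omega)).mul_right ih

/-- As i + 1 is neither border of the rectangle, i and i + 1 are both columns, both rows, or both
outside. The columns must reach up to n, since otherwise i could be the last column. -/
theorem Pi_commute_blk {i : Fin (n - 1)} {p j d : ℕ} (hp : i + 1 ≠ p)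
    (hq : i + 1 ≠ p + j) (hn : p + j + d = n) :
    Commute (Pi R i) (blk (natX R n) p (p + j) d j) := by
  by_cases h1 : p + j ≤ i
  · exact commute_blk fun a h2 h3 => Pi_commute_row (by omega) (by omega) (by omega)
  by_cases h2 : i + 1 < p
  · exact commute_blk fun a h3 h4 => commute_row fun b h5 h6 => Pi_commute_natX
      (by omega) (by omega) (by omega) (by omega)
  obtain ⟨e, he⟩ : ∃ e, i.val = p + e := ⟨i - p, by omega⟩
  obtain ⟨f, hf⟩ : ∃ f, j = e + 2 + f := ⟨j - e - 2, by omega⟩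
  have hb : blk (natX R n) p (p + j) d j = blk (natX R n) p (p + j) d e *
      (row (natX R n) i (p + j) d * row (natX R n) (i + 1) (p + j) d) *
      blk (natX R n) (p + (e + 2)) (p + j) d f := by
    conv_lhs => rw [hf, blk_append, blk_append]
    simp [blk, he, hf, add_assoc]
  rw [hb]
  refine Commute.mul_right (Commute.mul_right ?_ (Pi_commute_row_mul_row (by omega) d)) ?_
  · exact commute_blk fun a h3 h4 => commute_row fun b h5 h6 => Pi_commute_natX
      (by omega) (by omega) (by omega) (by omega)
  · exact commute_blk fun a h3 h4 => commute_row fun b h5 h6 => Pi_commute_natX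
      (by omega) (by omega) (by omega) (by omega)

/-- The full product factors as `X i (i + 1)` times an operator commuting with `π_i`. -/
theorem full_eq_X_mul (i : Fin (n - 1)) : ∃ T : RightOp R n, Commute (Pi R i) T ∧
    full (natX R n) n n = X R (pos i) (pos' i) * T := by
  have key : ∀ q, i + 2 + q ≤ n → ∃ T : RightOp R n, Commute (Pi R i) T ∧
      full (natX R n) n (i + 2 + q) = natX R n i (i + 1) * T := by
    intro q
    induction q with
    | zero =>
      intro hq
      refine ⟨row (natX R n) i (i + 2) (n - (i + 2)) * row (natX R n) (i + 1) (i + 2) (n - (i + 2)) *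
        full (natX R n) n i, (Pi_commute_row_mul_row (by omega) _).mul_right
          (commute_full fun a ha => Pi_commute_row ha (by omega) (by omega)), ?_⟩
      -- Row i ends with X_{i,i+1}; carrying this factor through the rows i and i + 1 brings it to
      -- the front and exchanges those rows. The remaining rows, of smaller index, commute with π_i.
      have h := natX_yangBaxter (R := R) (n := n).row_mul_row (a := i) (a' := i + 1) (l := i + 2)
        (by omega) (by omega) (n - (i + 2))
      rw [add_zero, full, full, show n - 1 - (i.val + 1) = n - (i + 2) by omega,
        show n - 1 - i.val = 1 + (n - (i + 2)) by omega, row_append, ← mul_assoc, ← mul_assoc,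
        ← mul_assoc, ← mul_assoc]
      rw [← h]
      simp only [row, mul_one, add_zero]
    | succ q ih =>
      intro hq
      obtain ⟨T, hT, h⟩ := ih (by omega)
      refine ⟨row (natX R n) (i + 2 + q) (i + 2 + q + 1) (n - 1 - (i + 2 + q)) * T,
        (commute_row fun b h1 h2 => Pi_commute_natX
          (by omega) (by omega) (by omega) (by omega)).mul_right hT, ?_⟩
      have c : Commute (natX R n i (i + 1))
          (row (natX R n) (i + 2 + q) (i + 2 + q + 1) (n - 1 - (i + 2 + q))) :=
        commute_row fun b h1 h2 =>
          natX_yangBaxter.comm (by omega) (by omega) (by omega) (by omega)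
      rw [← add_assoc, full, h, ← mul_assoc, ← c.eq, mul_assoc]
  obtain ⟨T, hT, h⟩ := key (n - (i + 2)) (by omega)
  refine ⟨T, hT, ?_⟩
  rw [show i.val + 2 + (n - (i + 2)) = n by omega] at h
  rw [h, ← natX_val]

variable (R) in
/-- The product of the operators attached to a list of pairs. -/
noncomputable def listOp (L : List (Fin n × Fin n)) : RightOp R n :=
  (L.map fun p => X R p.1 p.2).prod

theorem listOp_append (L L' : List (Fin n × Fin n)) :
    listOp R (L ++ L') = listOp R L * listOp R L' := by simp [listOp]

theorem listOp_blockList {m : ℕ} (k : Fin m → ℕ) (i : Fin m) (h1 : prevCut k i ≤ k i)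
    (h2 : k i ≤ n) : listOp R (blockList n k i) =
      blk (natX R n) (prevCut k i) (k i) (n - k i) (k i - prevCut k i) := by
  have e1 := finRange_filter_map_val (n := n) (l := prevCut k i) (j := k i - prevCut k i)
    (by omega)
  rw [Nat.add_sub_cancel' h1] at e1
  have e2 := finRange_filter_map_val (n := n) (l := k i) (j := n - k i) (by omega)
  have e3 : ((List.finRange n).filter fun b => k i ≤ b.val) =
      (List.finRange n).filter fun a => k i ≤ a.val ∧ a.val < k i + (n - k i) := by
    apply List.filter_congr
    intro a _
    have := a.isLt
    simp only [decide_eq_decide]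
    omega
  have hrow : ∀ a : Fin n, ((((List.finRange n).reverse.filter fun b => k i ≤ b.val).map
      fun b => (a, b)).map fun p => X R p.1 p.2).prod =
      row (natX R n) a (k i) (n - k i) := by
    intro a
    rw [row_eq_prod, ← e2, ← e3, List.filter_reverse, List.map_map, ← List.map_reverse,
      List.map_map]
    congr 1
    apply List.map_congr_left
    intro b _
    exact (natX_val a b).symm
  rw [listOp, blockList, prod_map_flatMap, blk_eq_prod, ← e1, List.map_map]
  congr 1
  apply List.map_congr_left
  intro a _
  exact hrow a

theorem prevCut_le {m : ℕ} {k : Fin m → ℕ} (hk : StrictMono k) (i : Fin m) :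
    prevCut k i ≤ k i := by
  unfold prevCut
  split_ifs
  · exact Nat.zero_le _
  · exact hk.monotone (by rw [Fin.le_def]; simp)

theorem Pi_commute_transpList {m : ℕ} {k : Fin m → ℕ} (hk : StrictMono k) (hn : ∀ j, k j < n)
    {i : Fin (n - 1)} (hi : ∀ j, k j ≠ i + 1) :
    Commute (Pi R i) (listOp R (transpList n k)) := by
  rw [listOp, transpList, prod_map_flatMap]
  apply Commute.list_prod_right
  intro y hy
  obtain ⟨j, -, rfl⟩ := List.mem_map.1 hy
  have h := listOp_blockList (R := R) k j (prevCut_le hk j) (hn j).le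
  rw [listOp] at h
  rw [h]
  have hle := prevCut_le hk j
  have := Pi_commute_blk (R := R) (i := i) (p := prevCut k j) (j := k j - prevCut k j)
    (d := n - k j) ?_ ?_ ?_
  · rwa [Nat.add_sub_cancel' hle] at this
  · unfold prevCut
    split_ifs
    · omega
    · exact (hi _).symm
  · rw [Nat.add_sub_cancel' hle]; exact (hi j).symm
  · have := hn j; omega

theorem transpList_succ {m : ℕ} (k : Fin (m + 1) → ℕ) :
    transpList n k = blockList n k (Fin.last m) ++ transpList n (k ∘ Fin.castSucc) := by
  rw [transpList, List.finRange_succ_last, List.reverse_append, List.flatMap_append,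
    ← List.map_reverse, List.flatMap_map]
  simp only [List.reverse_cons, List.reverse_nil, List.nil_append, List.flatMap_cons,
    List.flatMap_nil, List.append_nil]
  rfl

theorem prevCut_last {m : ℕ} (k : Fin (m + 1) → ℕ) :
    prevCut k (Fin.last m) = lastCut (k ∘ Fin.castSucc) := by
  cases m with
  | zero => rfl
  | succ m => rfl

/-- The positions `a < b` lie in the same block. -/
def SameBlock {m : ℕ} (k : Fin m → ℕ) (a b : ℕ) : Prop := a < b ∧ ∀ j, a < k j ↔ b < k j

theorem le_lastCut {m : ℕ} {k : Fin m → ℕ} (hk : StrictMono k) (j : Fin m) : k j ≤ lastCut k := by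
  cases m with
  | zero => exact j.elim0
  | succ m => exact hk.monotone (Fin.le_last j)

theorem full_lastCut {m : ℕ} {k : Fin m → ℕ} (hk : StrictMono k) (hn : ∀ j, k j < n) :
    ∃ I ∈ Submonoid.closure {y | ∃ a b, SameBlock k a b ∧ b < lastCut k ∧ y = natX R n a b},
      full (natX R n) n (lastCut k) = I * listOp R (transpList n k) := by
  induction m with
  | zero => exact ⟨1, one_mem _, by simp [full, lastCut, listOp, transpList]⟩
  | succ m ih =>
    have hk' : StrictMono (k ∘ Fin.castSucc) := hk.comp (Fin.strictMono_castSucc)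
    obtain ⟨I, hI, h⟩ := ih hk' (fun j => hn _)
    have hle := prevCut_le hk (Fin.last m)
    obtain ⟨I', hI', h'⟩ := natX_yangBaxter (R := R) (n := n).full_eq
      hle (hn (Fin.last m)).le
    -- The earlier inner factors involve only positions before the previous cut, and the rectangle
    -- only positions after it.
    have hc : Commute (blk (natX R n) (prevCut k (Fin.last m)) (k (Fin.last m))
        (n - k (Fin.last m)) (k (Fin.last m) - prevCut k (Fin.last m))) I := by
      clear h
      induction hI using Submonoid.closure_induction with
      | one => exact Commute.one_right _
      | mul y z _ _ hy hz => exact hy.mul_right hz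
      | mem y hy =>
        obtain ⟨a, b, hab, hb, rfl⟩ := hy
        have h1 := hab.1
        rw [← prevCut_last] at hb
        symm
        exact commute_blk fun c h2 h3 => commute_row fun d h4 h5 =>
          natX_yangBaxter.comm (by omega) (by omega) (by omega) (by omega)
    refine ⟨I' * I, mul_mem (Submonoid.closure_mono ?_ hI') (Submonoid.closure_mono ?_ hI), ?_⟩
    · rintro _ ⟨a, b, h1, h2, h3, rfl⟩
      refine ⟨a, b, ⟨h2, fun j => ?_⟩, h3, rfl⟩
      refine Fin.lastCases ?_ (fun j => ?_) j
      · omega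
      · have := le_lastCut hk' j
        rw [← prevCut_last] at this
        simp only [Function.comp_apply] at this
        omega
    · rintro _ ⟨a, b, ⟨h1, h2⟩, h3, rfl⟩
      rw [← prevCut_last] at h3
      have h4 : b < k (Fin.last m) := by omega
      refine ⟨a, b, ⟨h1, fun j => ?_⟩, h4, rfl⟩
      refine Fin.lastCases ?_ (fun j => h2 j) j
      omega
    · rw [transpList_succ, listOp_append, listOp_blockList k _ hle (hn _).le]
      change full (natX R n) n (k (Fin.last m)) = _
      rw [h', prevCut_last, h, ← prevCut_last, mul_assoc, mul_assoc, ← mul_assoc _ I, hc.eq]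
      simp only [mul_assoc]

/-- The full product is a product over pairs in the same block, times the product over the list
`𝒲`. -/
theorem full_eq_mul_transpList {m : ℕ} {k : Fin m → ℕ} (hk : StrictMono k) (hn : ∀ j, k j < n) :
    ∃ L : List (Fin n × Fin n), (∀ p ∈ L, SameBlock k p.1 p.2) ∧
      full (natX R n) n n = listOp R (L ++ transpList n k) := by
  have hle : lastCut k ≤ n := by
    cases m with
    | zero => exact Nat.zero_le _
    | succ m => exact (hn _).le
  obtain ⟨I, hI, h⟩ := full_lastCut (R := R) hk hn
  obtain ⟨I', hI', h'⟩ := natX_yangBaxter (R := R) (n := n).full_eq hle le_rfl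
  have hmem : I' * I ∈ Submonoid.closure {y | ∃ a b : Fin n, SameBlock k a b ∧ y = X R a b} := by
    refine mul_mem (Submonoid.closure_mono ?_ hI') (Submonoid.closure_mono ?_ hI)
    · rintro _ ⟨a, b, h1, h2, h3, rfl⟩
      refine ⟨⟨a, by omega⟩, ⟨b, h3⟩, ⟨h2, fun j => ?_⟩,
        natX_val (⟨a, by omega⟩ : Fin n) ⟨b, h3⟩⟩
      have := le_lastCut hk j
      simp only
      omega
    · rintro _ ⟨a, b, h1, h2, rfl⟩
      have h3 := h1.1
      exact ⟨⟨a, by omega⟩, ⟨b, by omega⟩, h1,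
        natX_val (⟨a, by omega⟩ : Fin n) ⟨b, by omega⟩⟩
  have hlist : ∀ y ∈ Submonoid.closure {y | ∃ a b : Fin n, SameBlock k a b ∧ y = X R a b},
      ∃ L : List (Fin n × Fin n), (∀ p ∈ L, SameBlock k p.1 p.2) ∧ y = listOp R L := by
    intro y hy
    induction hy using Submonoid.closure_induction with
    | one => exact ⟨[], by simp, rfl⟩
    | mem y hy =>
      obtain ⟨a, b, hab, rfl⟩ := hy
      exact ⟨[(a, b)], by simpa using hab, by simp [listOp]⟩
    | mul y z _ _ hy hz =>
      obtain ⟨L, hL, rfl⟩ := hy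
      obtain ⟨L', hL', rfl⟩ := hz
      refine ⟨L ++ L', fun p hp => ?_, (listOp_append _ _).symm⟩
      rcases List.mem_append.1 hp with hp | hp
      · exact hL p hp
      · exact hL' p hp
  obtain ⟨L, hL, e⟩ := hlist _ hmem
  refine ⟨L, hL, ?_⟩
  -- At q = n the rectangle has no columns, so the positions after the last cut contribute only
  -- inner pairs.
  rw [h', Nat.sub_self, blk_zero, mul_one, h, ← mul_assoc, e, listOp_append]

end CutOperator

/-! ### Evaluation of the product of the operators π̂ and π -/

section Expansion

variable {R : Type*} [CommRing R] {n : ℕ}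

theorem act_listOp_cons (σ : Perm (Fin n)) (p : Fin n × Fin n) (L : List (Fin n × Fin n)) :
    act (K R σ) (listOp R (p :: L)) = act (K R σ) (listOp R L) -
      if Cov σ p.1 p.2 then act (K R (σ * swap p.1 p.2)) (listOp R L) else 0 := by
  rw [show p :: L = [p] ++ L from rfl, listOp_append, act_mul]
  simp only [listOp, List.map_cons, List.map_nil, List.prod_cons, List.prod_nil, mul_one]
  rw [act_X, act_sub, act_ite, act_zero]

theorem act_listOp_of_not_cov {σ : Perm (Fin n)} {L : List (Fin n × Fin n)}
    (h : ∀ p ∈ L, ¬ Cov σ p.1 p.2) : act (K R σ) (listOp R L) = K R σ := by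
  induction L with
  | nil => exact act_one _
  | cons p L ih =>
    rw [act_listOp_cons, if_neg (h p (by simp)), sub_zero]
    exact ih fun q hq => h q (by simp [hq])

theorem act_full_of_descents {σ : Perm (Fin n)} (h : ∀ a b, a < b → σ b < σ a) :
    act (K R σ) (full (natX R n) n n) = K R σ := by
  -- An empty family of cuts serves only to write the full product as a product along a list of
  -- pairs.
  obtain ⟨L, -, e⟩ := full_eq_mul_transpList (R := R) (n := n) (k := (Fin.elim0 : Fin 0 → ℕ))
    (fun a => a.elim0) (fun a => a.elim0)
  rw [e]
  exact act_listOp_of_not_cov fun p _ hp => not_lt_of_gt hp.2.1 (h _ _ hp.1)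

/-- Write F = X_{i,i+1} T. The factor X_{i,i+1} fixes K_σ and sends K_{σ s_i} to K_{σ s_i} - K_σ =
K_σ (π_i - 1), and π_i passes through T. -/
theorem act_full_mul_simple {σ : Perm (Fin n)} {i : Fin (n - 1)} (h : σ (pos' i) < σ (pos i)) :
    act (K R (σ * simple i)) (full (natX R n) n n) =
      act (act (K R σ) (full (natX R n) n n)) (Pi R i) -
        act (K R σ) (full (natX R n) n n) := by
  obtain ⟨T, hT, e⟩ := full_eq_X_mul (R := R) i
  have h1 : ¬ Cov σ (pos i) (pos' i) := fun h' => not_lt_of_gt h h'.2.1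
  have h2 : Cov (σ * simple i) (pos i) (pos' i) := cov_simple.2 (by simpa using h)
  have h3 : σ * simple i * swap (pos i) (pos' i) = σ := mul_simple_mul_simple σ i
  rw [e, act_mul, act_mul, act_X, act_X, if_neg h1, if_pos h2, sub_zero, ← act_mul, ← hT.eq,
    act_mul, act_Pi, if_pos h, h3, act_sub]

theorem IsReducedWord.of_concat {u : List (Fin (n - 1))} {i : Fin (n - 1)} {τ : Perm (Fin n)}
    (h : IsReducedWord (u ++ [i]) τ) :
    IsReducedWord u (τ * simple i) ∧ τ (pos' i) < τ (pos i) := by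
  obtain ⟨h1, h2⟩ := h
  rw [wordProd_concat] at h1
  rw [List.length_append, List.length_singleton, len_eq_inv] at h2
  subst h1
  have h3 := inv_wordProd_le u
  have h4 := inv_mul_simple_le (wordProd u) i
  rw [mul_simple_mul_simple]
  refine ⟨⟨rfl, by rw [len_eq_inv]; omega⟩, ?_⟩
  rcases lt_or_gt_of_ne (apply_pos_ne (wordProd u) i) with h5 | h5
  · simpa using h5
  · have := inv_mul_simple' h5
    omega

/-- Each letter of a reduced word is one use of the recursion for F, because left multiplication by
ω turns ascents into descents. -/
theorem piHatWord_omega {u : List (Fin (n - 1))} {τ : Perm (Fin n)} (h : IsReducedWord u τ) :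
    piHatWord (K R (omega n)) u = act (K R (omega n * τ)) (full (natX R n) n n) := by
  induction u using List.reverseRecOn generalizing τ with
  | nil =>
    have : τ = 1 := h.1.symm
    rw [this, mul_one, act_full_of_descents]
    · rfl
    · intro a b hab
      exact Fin.rev_lt_rev.2 hab
  | append_singleton u i ih =>
    obtain ⟨h1, h2⟩ := h.of_concat
    have h3 : (omega n * (τ * simple i)) (pos' i) < (omega n * (τ * simple i)) (pos i) := by
      simp only [Perm.mul_apply, simple_pos, simple_pos']
      exact Fin.rev_lt_rev.2 h2
    have h4 := act_full_mul_simple (R := R) h3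
    rw [mul_assoc, mul_simple_mul_simple, ← ih h1] at h4
    rw [h4, piHatWord, List.foldl_append]
    rfl

theorem omega_mul_omega_mul (ζ : Perm (Fin n)) : omega n * (omega n * ζ) = ζ := by
  ext x
  simp [omega]

theorem piWord_eq_act {f : KSpace R n} {v : List (Fin (n - 1))} {i : Fin (n - 1)} :
    piWord f (v ++ [i]) = act (piWord f v) (Pi R i) := by
  rw [piWord, List.foldl_append]
  rfl

theorem simple_mem_parabolic {m : ℕ} {k : Fin m → ℕ} {i : Fin (n - 1)} :
    simple i ∈ parabolic (n := n) k ↔ ∀ j, k j ≠ i + 1 := by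
  constructor
  · intro h j hj
    have := h j (pos i)
    rw [simple_pos] at this
    simp only [hj] at this
    omega
  · intro h j y
    have := h j
    simp only [simple_eq, swap_apply_def]
    split_ifs with h1 h2
    · subst h1; simp only; omega
    · subst h2; simp only; omega
    · rfl

/-- At a cut, τ sends the position before it below the cut value and the position after it to at
least that value. So reduced words of parabolic elements contain no cut letter. -/
theorem cut_ne_of_descent {m : ℕ} {k : Fin m → ℕ} {i : Fin (n - 1)} {τ : Perm (Fin n)}
    (hτ : τ ∈ parabolic (n := n) k) (h : τ (pos' i) < τ (pos i)) (j : Fin m) : k j ≠ i + 1 := by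
  intro hj
  have h1 := hτ j (pos i)
  have h2 := hτ j (pos' i)
  simp only [hj, Fin.lt_def] at h1 h2 h
  omega

/-- The letters are not cuts, so π_i passes through the product over 𝒲 and acts on the basis vector,
where the descents of ζ inside blocks make it multiply by s_i. -/
theorem piWord_parabolic {m : ℕ} {k : Fin m → ℕ} (hk : StrictMono k) (hn : ∀ j, k j < n)
    {ζ : Perm (Fin n)} (hζ : ∀ a b : Fin n, SameBlock k a b → ζ b < ζ a)
    {v : List (Fin (n - 1))} {τ : Perm (Fin n)} (hv : IsReducedWord v τ)
    (hτ : τ ∈ parabolic (n := n) k) :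
    piWord (act (K R ζ) (listOp R (transpList n k))) v =
      act (K R (ζ * τ)) (listOp R (transpList n k)) := by
  induction v using List.reverseRecOn generalizing τ with
  | nil =>
    have : τ = 1 := hv.1.symm
    rw [this, mul_one]
    rfl
  | append_singleton v i ih =>
    obtain ⟨h1, h2⟩ := hv.of_concat
    have hcut := cut_ne_of_descent hτ h2
    have h3 : τ * simple i ∈ parabolic (n := n) k :=
      mul_mem hτ (simple_mem_parabolic.2 hcut)
    have h4 : (ζ * (τ * simple i)) (pos' i) < (ζ * (τ * simple i)) (pos i) := by
      simp only [Perm.mul_apply, simple_pos, simple_pos']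
      refine hζ _ _ ⟨h2, fun j => ?_⟩
      rw [hτ j, hτ j]
      have := hcut j
      simp only
      omega
    rw [piWord_eq_act, ih h1 h3, ← act_mul, ← (Pi_commute_transpList hk hn hcut).eq, act_mul,
      act_Pi, if_pos h4, mul_assoc, mul_simple_mul_simple]

theorem expansion {m : ℕ} {k : Fin m → ℕ} (hk : StrictMono k) (hn : ∀ j, k j < n)
    {σ ζ : Perm (Fin n)} (hζ : ∀ a b : Fin n, SameBlock k a b → ζ b < ζ a)
    (hσ : ζ⁻¹ * σ ∈ parabolic (n := n) k)
    {u v : List (Fin (n - 1))} (hu : IsReducedWord u (omega n * ζ))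
    (hv : IsReducedWord v (ζ⁻¹ * σ)) :
    piWord (piHatWord (K R (omega n)) u) v = act (K R σ) (listOp R (transpList n k)) := by
  obtain ⟨L, hL, e⟩ := full_eq_mul_transpList (R := R) hk hn
  rw [piHatWord_omega hu, omega_mul_omega_mul, e, listOp_append, act_mul,
    act_listOp_of_not_cov (fun p hp hc => not_lt_of_gt hc.2.1 (hζ _ _ (hL p hp))),
    piWord_parabolic hk hn hζ hv hσ, mul_inv_cancel_left]

end Expansion

/-! ### Subwords as Bruhat paths, and their number -/

section Paths

variable {n : ℕ}

theorem mulWord_cons (σ : Perm (Fin n)) (p : Fin n × Fin n) (w : List (Fin n × Fin n)) :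
    mulWord σ (p :: w) = mulWord (σ * swap p.1 p.2) w := by
  simp [mulWord, mul_assoc]

theorem isBruhatPath_cons {σ : Perm (Fin n)} {p : Fin n × Fin n} (hp : p.1 < p.2)
    {w : List (Fin n × Fin n)} :
    IsBruhatPath σ (p :: w) ↔ Cov σ p.1 p.2 ∧ IsBruhatPath (σ * swap p.1 p.2) w := by
  rw [IsBruhatPath, isBruhatTransposition_swap hp]

theorem prevCut_ge {m : ℕ} {k : Fin m → ℕ} (hk : StrictMono k) {i j : Fin m} (h : i < j) :
    k i ≤ prevCut k j := by
  unfold prevCut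
  split_ifs with h0
  · exact absurd h (by rw [Fin.lt_def]; omega)
  · exact hk.monotone (by rw [Fin.le_def]; simp only [Fin.lt_def] at h ⊢; omega)

theorem mem_blockList {m : ℕ} {k : Fin m → ℕ} {i : Fin m} {p : Fin n × Fin n} :
    p ∈ blockList n k i ↔ (prevCut k i ≤ p.1.val ∧ p.1.val < k i) ∧ k i ≤ p.2.val := by
  obtain ⟨a, b⟩ := p
  simp [blockList]

theorem mem_transpList {m : ℕ} {k : Fin m → ℕ} {p : Fin n × Fin n} (hp : p ∈ transpList n k) :
    p.1 < p.2 ∧ ∃ j, p.1.val < k j ∧ k j ≤ p.2.val := by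
  simp only [transpList, List.mem_flatMap, mem_blockList] at hp
  obtain ⟨i, -, h1, h2⟩ := hp
  exact ⟨by rw [Fin.lt_def]; omega, i, h1.2, h2⟩

theorem nodup_transpList {m : ℕ} {k : Fin m → ℕ} (hk : StrictMono k) :
    (transpList n k).Nodup := by
  rw [transpList, List.nodup_flatMap]
  constructor
  · intro i _
    rw [blockList, List.nodup_flatMap]
    constructor
    · intro a _
      refine List.Nodup.map (fun b b' h => (Prod.mk.inj h).2) (List.Nodup.filter _ ?_)
      exact List.nodup_reverse.2 (List.nodup_finRange n)
    · refine List.Pairwise.imp ?_ ((List.nodup_finRange n).filter _)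
      intro a b hab p hp hq
      simp only [List.mem_map] at hp hq
      obtain ⟨c, -, rfl⟩ := hp
      obtain ⟨d, -, h⟩ := hq
      exact hab (Prod.mk.inj h).1.symm
  · refine List.Pairwise.imp ?_ (List.nodup_reverse.2 (List.nodup_finRange m))
    intro i j hij p hp hq
    rw [mem_blockList] at hp hq
    rcases lt_or_gt_of_ne hij with h | h
    · have := prevCut_ge hk h
      omega
    · have := prevCut_ge hk h
      omega

open Classical in
-- Expanding the first factor decides whether its letter is used. Absence of repetitions keeps the
-- words of the two kinds disjoint.
theorem act_listOp_eq_sum {R : Type*} [CommRing R] {L : List (Fin n × Fin n)} (hL : L.Nodup)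
    (hlt : ∀ p ∈ L, p.1 < p.2) (σ : Perm (Fin n)) :
    act (K R σ) (listOp R L) = ∑ w ∈ L.sublists.toFinset.filter fun w => IsBruhatPath σ w,
      ((-1 : R) ^ w.length) • K R (mulWord σ w) := by
  induction L generalizing σ with
  | nil =>
    have : (([] : List (Fin n × Fin n)).sublists.toFinset.filter fun w => IsBruhatPath σ w) =
        {[]} := by
      ext w
      simp only [Finset.mem_filter, List.mem_toFinset, List.mem_sublists, List.sublist_nil,
        Finset.mem_singleton, and_iff_left_iff_imp]
      rintro rfl
      trivial
    rw [this, Finset.sum_singleton]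
    simp [mulWord, listOp]
  | cons p L ih =>
    rw [List.nodup_cons] at hL
    have hp := hlt p (by simp)
    have hlt' : ∀ q ∈ L, q.1 < q.2 := fun q hq => hlt q (by simp [hq])
    rw [act_listOp_cons, ih hL.2 hlt', ih hL.2 hlt']
    have hset : ((p :: L).sublists.toFinset.filter fun w => IsBruhatPath σ w) =
        (L.sublists.toFinset.filter fun w => IsBruhatPath σ w) ∪
        (if Cov σ p.1 p.2 then (L.sublists.toFinset.filter fun w =>
          IsBruhatPath (σ * swap p.1 p.2) w) else ∅).image (List.cons p) := by
      ext w
      simp only [Finset.mem_filter, List.mem_toFinset, List.mem_sublists, Finset.mem_union,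
        Finset.mem_image, List.sublist_cons_iff]
      constructor
      · rintro ⟨h | ⟨r, rfl, h⟩, h'⟩
        · exact Or.inl ⟨h, h'⟩
        · rw [isBruhatPath_cons hp] at h'
          exact Or.inr ⟨r, by rw [if_pos h'.1]; simp [h, h'.2], rfl⟩
      · rintro (h | ⟨r, hr, rfl⟩)
        · exact ⟨Or.inl h.1, h.2⟩
        · split_ifs at hr with hc
          · simp only [Finset.mem_filter, List.mem_toFinset, List.mem_sublists] at hr
            exact ⟨Or.inr ⟨r, rfl, hr.1⟩, (isBruhatPath_cons hp).2 ⟨hc, hr.2⟩⟩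
          · simp at hr
    rw [hset, Finset.sum_union, Finset.sum_image (fun a _ b _ h => (List.cons.inj h).2)]
    · rw [sub_eq_add_neg]
      congr 1
      split_ifs
      · rw [← Finset.sum_neg_distrib]
        refine Finset.sum_congr rfl fun w _ => ?_
        rw [mulWord_cons, List.length_cons, pow_succ, mul_neg_one, neg_smul]
      · simp
    · rw [Finset.disjoint_left]
      intro w hw hw'
      simp only [Finset.mem_filter, List.mem_toFinset, List.mem_sublists] at hw
      obtain ⟨r, -, rfl⟩ := Finset.mem_image.1 hw'
      exact hL.1 (hw.1.subset (by simp))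

theorem chainSum_eq_act {R : Type*} [CommRing R] {m : ℕ} {k : Fin m → ℕ} (hk : StrictMono k)
    (σ : Perm (Fin n)) : chainSum R k σ = act (K R σ) (listOp R (transpList n k)) :=
  (act_listOp_eq_sum (nodup_transpList hk) (fun _ hp => (mem_transpList hp).1) σ).symm

/-- The number of subwords of `L` that are Bruhat paths from `σ` to `μ`. -/
def pathCount : List (Fin n × Fin n) → Perm (Fin n) → Perm (Fin n) → ℕ
  | [], σ, μ => if σ = μ then 1 else 0
  | p :: L, σ, μ => pathCount L σ μ +
      if Cov σ p.1 p.2 then pathCount L (σ * swap p.1 p.2) μ else 0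

/-- Each step raises the inversion number by one, so the sign depends only on the endpoints and
paths to the same permutation cannot cancel. -/
theorem act_listOp_apply {R : Type*} [CommRing R] (L : List (Fin n × Fin n))
    (σ μ : Perm (Fin n)) :
    act (K R σ) (listOp R L) μ = (-1) ^ (inv σ + inv μ) * (pathCount L σ μ : R) := by
  induction L generalizing σ with
  | nil =>
    change (K R σ) μ = _
    rw [K, Finsupp.single_apply, pathCount]
    split_ifs with h
    · rw [h, ← two_mul, pow_mul]; simp
    · simp
  | cons p L ih =>
    rw [act_listOp_cons, Finsupp.sub_apply, ih, pathCount]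
    split_ifs with h
    · rw [ih, h.inv_eq, Nat.cast_add]
      ring
    · simp

theorem pathCount_append_pos {L L' : List (Fin n × Fin n)} {σ μ : Perm (Fin n)} :
    0 < pathCount (L ++ L') σ μ ↔ ∃ γ, 0 < pathCount L σ γ ∧ 0 < pathCount L' γ μ := by
  induction L generalizing σ with
  | nil =>
    simp only [pathCount, List.nil_append]
    constructor
    · exact fun h => ⟨σ, by simp, h⟩
    · rintro ⟨γ, h1, h2⟩
      split_ifs at h1 with e
      · exact e ▸ h2
      · exact absurd h1 (lt_irrefl _)
  | cons p L ih =>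
    rw [List.cons_append, pathCount, Nat.add_pos_iff_pos_or_pos, ih]
    simp only [pathCount, Nat.add_pos_iff_pos_or_pos]
    split_ifs
    · rw [ih, ← exists_or]
      simp only [or_and_right]
    · simp

/-- Paths through different intermediate permutations are counted separately. This is what
contradicts uniqueness when two intermediate points exist. -/
theorem pathCount_append_add {L L' : List (Fin n × Fin n)} {σ μ γ γ' : Perm (Fin n)}
    (hne : γ ≠ γ') (h1 : 0 < pathCount L σ γ) (h2 : 0 < pathCount L σ γ')
    (h3 : 0 < pathCount L' γ μ) (h4 : 0 < pathCount L' γ' μ) :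
    1 < pathCount (L ++ L') σ μ := by
  have hle : ∀ (L : List (Fin n × Fin n)) σ, pathCount L σ γ * pathCount L' γ μ +
      pathCount L σ γ' * pathCount L' γ' μ ≤ pathCount (L ++ L') σ μ := by
    intro L
    induction L with
    | nil =>
      intro σ
      simp only [pathCount, List.nil_append]
      split_ifs with h5 h6 h6
      · exact absurd (h5.symm.trans h6) hne
      · subst h5; simp
      · subst h6; simp
      · simp
    | cons p L ih =>
      intro σ
      simp only [pathCount, List.cons_append]
      split_ifs
      · have := ih σ
        have := ih (σ * swap p.1 p.2)
        nlinarith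
      · simpa using ih σ
  have := hle L σ
  have := Nat.mul_pos h1 h3
  have := Nat.mul_pos h2 h4
  omega

theorem pathCount_pos_iff {L : List (Fin n × Fin n)} (hlt : ∀ p ∈ L, p.1 < p.2)
    {σ μ : Perm (Fin n)} :
    0 < pathCount L σ μ ↔ ∃ w, w.Sublist L ∧ IsBruhatPath σ w ∧ mulWord σ w = μ := by
  induction L generalizing σ with
  | nil =>
    simp only [pathCount, List.sublist_nil]
    split_ifs with h
    · simp [IsBruhatPath, mulWord, h]
    · simp [mulWord, h]
  | cons p L ih =>
    have hp := hlt p (by simp)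
    have hlt' : ∀ q ∈ L, q.1 < q.2 := fun q hq => hlt q (by simp [hq])
    rw [pathCount, Nat.add_pos_iff_pos_or_pos, ih hlt']
    constructor
    · rintro (⟨w, h1, h2, h3⟩ | h)
      · exact ⟨w, h1.cons p, h2, h3⟩
      · split_ifs at h with hc
        · obtain ⟨w, h1, h2, h3⟩ := (ih hlt').1 h
          exact ⟨p :: w, h1.cons_cons p, (isBruhatPath_cons hp).2 ⟨hc, h2⟩, by
            rwa [mulWord_cons]⟩
        · exact absurd h (lt_irrefl _)
    · rintro ⟨w, h1, h2, h3⟩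
      rcases List.sublist_cons_iff.1 h1 with h | ⟨r, rfl, h⟩
      · exact Or.inl ⟨w, h, h2, h3⟩
      · rw [isBruhatPath_cons hp] at h2
        rw [mulWord_cons] at h3
        right
        rw [if_pos h2.1]
        exact (ih hlt').2 ⟨r, h, h2.2, h3⟩

theorem eq_of_pathCount_le_one {L : List (Fin n × Fin n)} (hlt : ∀ p ∈ L, p.1 < p.2)
    {σ μ : Perm (Fin n)} (hone : pathCount L σ μ ≤ 1) {w w' : List (Fin n × Fin n)}
    (h1 : w.Sublist L) (h2 : IsBruhatPath σ w) (h3 : mulWord σ w = μ)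
    (h1' : w'.Sublist L) (h2' : IsBruhatPath σ w') (h3' : mulWord σ w' = μ) : w = w' := by
  induction L generalizing σ w w' with
  | nil => rw [List.sublist_nil.1 h1, List.sublist_nil.1 h1']
  | cons p L ih =>
    have hp := hlt p (by simp)
    have hlt' : ∀ q ∈ L, q.1 < q.2 := fun q hq => hlt q (by simp [hq])
    rw [pathCount] at hone
    rcases List.sublist_cons_iff.1 h1 with h | ⟨r, rfl, h⟩ <;>
      rcases List.sublist_cons_iff.1 h1' with h' | ⟨r', rfl, h'⟩
    · exact ih hlt' (by omega) h h2 h3 h' h2' h3'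
    · rw [isBruhatPath_cons hp] at h2'
      rw [mulWord_cons] at h3'
      rw [if_pos h2'.1] at hone
      have := (pathCount_pos_iff hlt').2 ⟨w, h, h2, h3⟩
      have := (pathCount_pos_iff hlt').2 ⟨r', h', h2'.2, h3'⟩
      omega
    · rw [isBruhatPath_cons hp] at h2
      rw [mulWord_cons] at h3
      rw [if_pos h2.1] at hone
      have := (pathCount_pos_iff hlt').2 ⟨w', h', h2', h3'⟩
      have := (pathCount_pos_iff hlt').2 ⟨r, h, h2.2, h3⟩
      omega
    · rw [isBruhatPath_cons hp] at h2 h2'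
      rw [mulWord_cons] at h3 h3'
      rw [if_pos h2.1] at hone
      rw [ih hlt' (by omega) h h2.2 h3 h' h2'.2 h3']

theorem bruhatLE_of_pathCount_pos {L : List (Fin n × Fin n)} {σ μ : Perm (Fin n)}
    (h : 0 < pathCount L σ μ) : BruhatLE σ μ := by
  induction L generalizing σ with
  | nil =>
    rw [pathCount] at h
    split_ifs at h with h'
    · exact h' ▸ bruhatLE_refl _
    · exact absurd h (lt_irrefl _)
  | cons p L ih =>
    rw [pathCount, Nat.add_pos_iff_pos_or_pos] at h
    rcases h with h | h
    · exact ih h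
    · split_ifs at h with hc
      · exact hc.bruhatLE.trans (ih h)
      · exact absurd h (lt_irrefl _)

end Paths

/-! ### Lifting property, and the full product as a sum over an upper Bruhat set -/

section Bruhat

variable {n : ℕ}

/-- The longer one of `μ` and `μ s_i`. -/
def up (i : Fin (n - 1)) (μ : Perm (Fin n)) : Perm (Fin n) :=
  if μ (pos i) < μ (pos' i) then μ * simple i else μ

theorem bruhatLE_up (i : Fin (n - 1)) (μ : Perm (Fin n)) : BruhatLE μ (up i μ) := by
  unfold up
  split_ifs with h
  · exact bruhatLE_mul_simple h
  · exact bruhatLE_refl _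

/-- When exactly one of the positions i, i + 1 is exchanged and the other lies between a and b, the
cover condition keeps the latter's value out of the way; otherwise the ascent only widens or is
untouched. -/
theorem Cov.ascent_mul_swap {μ : Perm (Fin n)} {a b : Fin n} (hc : Cov μ a b) {i : Fin (n - 1)}
    (hne : ¬ (a = pos i ∧ b = pos' i)) (h : μ (pos i) < μ (pos' i)) :
    (μ * swap a b) (pos i) < (μ * swap a b) (pos' i) := by
  obtain ⟨hab, hv, hm⟩ := hc
  have hii := pos_lt i
  simp only [Perm.mul_apply]
  by_cases h1 : pos i = a
  · subst h1
    have hb : b ≠ pos' i := fun hb => hne ⟨rfl, hb⟩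
    rw [swap_apply_left, swap_apply_of_ne_of_ne hii.ne' hb.symm]
    have hlt : pos' i < b := lt_of_le_of_ne (by rw [Fin.le_def]; exact hab) hb.symm
    exact lt_of_le_of_ne (not_lt.1 fun h' => hm _ hii hlt h h') fun h' => hb (μ.injective h')
  by_cases h2 : pos i = b
  · subst h2
    rw [swap_apply_right, swap_apply_of_ne_of_ne (hab.trans hii).ne' hii.ne']
    exact hv.trans h
  rw [swap_apply_of_ne_of_ne h1 h2]
  by_cases h3 : pos' i = a
  · subst h3
    rw [swap_apply_left]
    exact h.trans hv
  by_cases h4 : pos' i = b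
  · subst h4
    rw [swap_apply_right]
    have hlt : a < pos i := lt_of_le_of_ne (by
      have : a.val < i.val + 1 := hab
      rw [Fin.le_def]; simp only; omega) (Ne.symm h1)
    exact lt_of_le_of_ne (not_lt.1 fun h' => hm _ hlt hii h' h) fun h' => h1 (μ.injective h')
  rwa [swap_apply_of_ne_of_ne h3 h4]

/-- This is the lifting property for one cover: either the cover is s_i itself, or conjugation by
s_i gives a cover of the lifted elements, or the smaller element needs no lift. -/
theorem Cov.up_le {μ : Perm (Fin n)} {a b : Fin n} (hc : Cov μ a b) (i : Fin (n - 1)) :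
    BruhatLE (up i μ) (up i (μ * swap a b)) := by
  by_cases h : μ (pos i) < μ (pos' i)
  · by_cases hab : a = pos i ∧ b = pos' i
    · obtain ⟨rfl, rfl⟩ := hab
      have : up i μ = μ * swap (pos i) (pos' i) := if_pos h
      rw [this]
      exact bruhatLE_up _ _
    · have h' := hc.ascent_mul_swap hab h
      have e : μ * swap a b * simple i = μ * simple i * swap (simple i a) (simple i b) := by
        have e1 := swap_apply_apply (simple i) a b
        rw [show (simple i)⁻¹ = simple i from swap_inv _ _] at e1
        rw [e1]
        simp only [← mul_assoc, mul_simple_mul_simple]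
      rw [up, if_pos h, up, if_pos h']
      refine Relation.ReflTransGen.single ⟨swap (simple i a) (simple i b),
        ⟨⟨_, _, (simple i).injective.ne hc.1.ne, rfl⟩, ?_⟩, e⟩
      rw [← e, len_eq_inv, len_eq_inv, inv_mul_simple h, inv_mul_simple h', hc.inv_eq]
  · rw [up, if_neg h]
    exact hc.bruhatLE.trans (bruhatLE_up _ _)

theorem BruhatLE.up_le {σ μ : Perm (Fin n)} (h : BruhatLE σ μ) (i : Fin (n - 1)) :
    BruhatLE (up i σ) (up i μ) :=
  h.induction (P := fun μ => BruhatLE (up i σ) (up i μ)) (bruhatLE_refl _)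
    fun _ _ _ _ hc h => h.trans (hc.up_le i)

theorem K_apply {R : Type*} [CommRing R] (σ μ : Perm (Fin n)) :
    (K R σ) μ = if σ = μ then 1 else 0 := by
  rw [K, Finsupp.single_apply]

/-- Up to sign, the coefficient at μ is the old coefficient at `up i μ`; this matches the lifting
property. -/
theorem act_Pi_sub_apply {R : Type*} [CommRing R] (f : KSpace R n) (i : Fin (n - 1))
    (μ : Perm (Fin n)) : (act f (Pi R i) - f) μ =
      if μ (pos i) < μ (pos' i) then f (μ * simple i) else - f μ := by
  induction f using Finsupp.induction_linear with
  | zero => simp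
  | add f g hf hg =>
    have : act (f + g) (Pi R i) = act f (Pi R i) + act g (Pi R i) := map_add _ _ _
    rw [this, add_sub_add_comm, Finsupp.add_apply, hf, hg]
    split_ifs
    · rfl
    · rw [Finsupp.add_apply, neg_add]
  | single σ r =>
    have h1 : (Finsupp.single σ r : KSpace R n) = r • K R σ := by simp [K]
    have h2 : act (r • K R σ) (Pi R i) = r • act (K R σ) (Pi R i) := map_smul _ _ _
    have key : (act (K R σ) (Pi R i) - K R σ) μ =
        if μ (pos i) < μ (pos' i) then K R σ (μ * simple i) else - K R σ μ := by
      have e : K R (σ * simple i) μ = K R σ (μ * simple i) := by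
        have : σ * simple i = μ ↔ σ = μ * simple i := by
          constructor <;> rintro rfl <;> simp
        simp only [K_apply, this]
      rw [act_Pi, Finsupp.sub_apply]
      by_cases hσ : σ (pos' i) < σ (pos i) <;> by_cases hμ : μ (pos i) < μ (pos' i)
      · rw [if_pos hσ, if_pos hμ, e, K_apply σ μ, if_neg, sub_zero]
        rintro rfl
        exact not_lt_of_gt hσ hμ
      · rw [if_pos hσ, if_neg hμ, e, K_apply σ (μ * simple i), if_neg, zero_sub]
        rintro rfl
        simp only [Perm.mul_apply, simple_pos, simple_pos'] at hσ
        exact hμ hσ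
      · rw [if_neg hσ, if_pos hμ, sub_self, K_apply, if_neg]
        rintro rfl
        simp only [Perm.mul_apply, simple_pos, simple_pos'] at hσ
        exact hσ hμ
      · rw [if_neg hσ, if_neg hμ, sub_self, K_apply, if_neg, neg_zero]
        rintro rfl
        exact hσ (lt_of_le_of_ne (not_lt.1 hμ) (apply_pos_ne σ i).symm)
    rw [h1, h2, ← smul_sub, Finsupp.smul_apply, key, Finsupp.smul_apply, Finsupp.smul_apply]
    split_ifs <;> simp

theorem inv_le (σ : Perm (Fin n)) : inv σ ≤ n * n := by
  refine (Finset.card_filter_le _ _).trans ?_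
  simp

theorem bruhatLE_iff_eq_of_descents {σ μ : Perm (Fin n)} (h : ∀ a b, a < b → σ b < σ a) :
    BruhatLE σ μ ↔ σ = μ := by
  constructor
  · intro h'
    rcases Relation.ReflTransGen.cases_head h' with h' | ⟨ν, h1, -⟩
    · exact h'
    · obtain ⟨a, b, hc, -⟩ := exists_cov_iff.1 h1
      exact absurd hc.2.1 (not_lt_of_gt (h _ _ hc.1))
  · rintro rfl
    exact bruhatLE_refl _

open Classical in
/-- The full product sends `K_σ` to the alternating sum over the upper Bruhat set of `σ`. -/
theorem act_full_apply (σ μ : Perm (Fin n)) :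
    act (K ℤ σ) (full (natX ℤ n) n n) μ =
      if BruhatLE σ μ then (-1) ^ (inv σ + inv μ) else 0 := by
  induction hd : n * n - inv σ using Nat.strong_induction_on generalizing σ μ with
  | _ d ih =>
    by_cases hdesc : ∀ i : Fin (n - 1), σ (pos' i) < σ (pos i)
    · have h : ∀ a b, a < b → σ b < σ a := fun a b hab =>
        lt_of_adjacent (P := fun a b => σ b < σ a) (fun _ _ _ h1 h2 => h2.trans h1) hab
          fun i _ _ => hdesc i
      rw [act_full_of_descents h, bruhatLE_iff_eq_of_descents h, K_apply]
      split_ifs with e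
      · rw [e, ← two_mul, pow_mul]; simp
      · rfl
    · push Not at hdesc
      obtain ⟨i, hi⟩ := hdesc
      have hi := lt_of_le_of_ne hi (apply_pos_ne σ i)
      have hinv := inv_mul_simple hi
      have hbound := inv_le (σ * simple i)
      have hrec := act_full_mul_simple (R := ℤ) (σ := σ * simple i) (i := i) (by simpa using hi)
      rw [mul_simple_mul_simple] at hrec
      have hup : BruhatLE σ μ → BruhatLE (σ * simple i) (up i μ) := fun h => by
        have := h.up_le i
        rwa [up, if_pos hi] at this
      -- A nonzero coefficient requires a path from σ to μ, so only one direction of the lifting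
      -- property is needed.
      have hpos : ¬ BruhatLE σ μ → act (K ℤ σ) (full (natX ℤ n) n n) μ = 0 := by
        intro h
        obtain ⟨L, -, e⟩ := full_eq_mul_transpList (R := ℤ) (n := n) (k := (Fin.elim0 : Fin 0 → ℕ))
          (fun a => a.elim0) (fun a => a.elim0)
        rw [e, act_listOp_apply]
        by_contra hne
        exact h (bruhatLE_of_pathCount_pos (Nat.pos_of_ne_zero fun h0 => hne (by rw [h0]; simp)))
      split_ifs with h
      · rw [hrec, act_Pi_sub_apply]
        have h' := hup h
        unfold up at h'
        split_ifs at h' ⊢ with hμ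
        · rw [ih _ (by omega) _ _ rfl, if_pos h', hinv, inv_mul_simple hμ]
          ring
        · rw [ih _ (by omega) _ _ rfl, if_pos h', hinv]
          ring
      · exact hpos h

open Classical in
-- The integer coefficient is the path count up to a nonzero sign, so the count itself can be read
-- off.
theorem pathCount_eq_ite {L : List (Fin n × Fin n)}
    (hL : full (natX ℤ n) n n = listOp ℤ L) (σ μ : Perm (Fin n)) :
    pathCount L σ μ = if BruhatLE σ μ then 1 else 0 := by
  have h := act_full_apply σ μ
  rw [hL, act_listOp_apply] at h
  have hunit : ((-1 : ℤ) ^ (inv σ + inv μ)) ≠ 0 := pow_ne_zero _ (by norm_num)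
  split_ifs at h ⊢ with h1
  · have := mul_left_cancel₀ hunit (h.trans (mul_one _).symm)
    exact_mod_cast this
  · rcases mul_eq_zero.1 h with h | h
    · exact absurd h hunit
    · exact_mod_cast h

end Bruhat

/-! ### Maximal and minimal elements of parabolic cosets -/

section Coset

variable {n m : ℕ} {k : Fin m → ℕ}

theorem swap_mem_parabolic {a b : Fin n} (h : SameBlock k a b) :
    swap a b ∈ parabolic (n := n) k := by
  intro j y
  have := h.2 j
  rw [swap_apply_def]
  split_ifs with h1 h2
  · subst h1; exact this.symm
  · subst h2; exact this
  · rfl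

/-- Positions in different blocks keep their order under any parabolic element, so being increasing
on each block means being increasing. -/
theorem eq_one_of_mem_parabolic {g : Perm (Fin n)} (hg : g ∈ parabolic (n := n) k)
    (h : ∀ a b : Fin n, SameBlock k a b → g a < g b) : g = 1 := by
  refine eq_one_of_strictMono fun a b hab => ?_
  by_cases hs : ∀ j, a.val < k j ↔ b.val < k j
  · exact h a b ⟨hab, hs⟩
  · push Not at hs
    obtain ⟨j, hj⟩ := hs
    have h1 := hg j a
    have h2 := hg j b
    simp only [Fin.lt_def] at hab hj ⊢
    omega

theorem SameBlock.of_parabolic {g : Perm (Fin n)} (hg : g ∈ parabolic (n := n) k) {a b : Fin n}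
    (h : SameBlock k a b) (hlt : g b < g a) : SameBlock k (g b) (g a) :=
  ⟨hlt, fun j => by rw [hg j, hg j, h.2 j]⟩

theorem eq_of_descents {σ μ : Perm (Fin n)} (h : σ⁻¹ * μ ∈ parabolic (n := n) k)
    (hσ : ∀ a b : Fin n, SameBlock k a b → σ b < σ a)
    (hμ : ∀ a b : Fin n, SameBlock k a b → μ b < μ a) : σ = μ := by
  rw [← inv_mul_eq_one]
  refine eq_one_of_mem_parabolic h fun a b hab => ?_
  refine lt_of_le_of_ne (not_lt.1 fun hlt => ?_)
    fun he => absurd ((σ⁻¹ * μ).injective he) (by intro e; exact hab.1.ne (congrArg _ e))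
  have := hσ _ _ (hab.of_parabolic h hlt)
  have e : ∀ y, σ ((σ⁻¹ * μ) y) = μ y := fun y => σ.apply_symm_apply _
  rw [e, e] at this
  exact not_lt_of_gt this (hμ a b hab)

theorem eq_of_ascents {σ μ : Perm (Fin n)} (h : σ⁻¹ * μ ∈ parabolic (n := n) k)
    (hσ : ∀ a b : Fin n, SameBlock k a b → σ a < σ b)
    (hμ : ∀ a b : Fin n, SameBlock k a b → μ a < μ b) : σ = μ := by
  rw [← inv_mul_eq_one]
  refine eq_one_of_mem_parabolic h fun a b hab => ?_
  refine lt_of_le_of_ne (not_lt.1 fun hlt => ?_)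
    fun he => absurd ((σ⁻¹ * μ).injective he) (by intro e; exact hab.1.ne (congrArg _ e))
  have := hσ _ _ (hab.of_parabolic h hlt)
  have e : ∀ y, σ ((σ⁻¹ * μ) y) = μ y := fun y => σ.apply_symm_apply _
  rw [e, e] at this
  exact not_lt_of_gt this (hμ a b hab)

theorem sameBlock_of_adjacent {P : Fin n → Fin n → Prop}
    (htrans : ∀ a b c, P a b → P b c → P a c)
    (h : ∀ i : Fin (n - 1), (∀ j, k j ≠ i + 1) → P (pos i) (pos' i)) {a b : Fin n}
    (hab : SameBlock k a b) : P a b := by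
  refine lt_of_adjacent htrans (Fin.lt_def.2 hab.1) fun i h1 h2 => h i fun j hj => ?_
  have := hab.2 j
  simp only [Fin.le_def] at h1 h2
  omega

theorem inv_mul_mul_simple_mem {σ μ : Perm (Fin n)} (h : σ⁻¹ * μ ∈ parabolic (n := n) k)
    {i : Fin (n - 1)} (hi : ∀ j, k j ≠ i + 1) : σ⁻¹ * (μ * simple i) ∈ parabolic (n := n) k := by
  rw [← mul_assoc]
  exact mul_mem h (simple_mem_parabolic.2 hi)

theorem inv_mul_mem_trans {σ μ ν : Perm (Fin n)} (h : σ⁻¹ * μ ∈ parabolic (n := n) k)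
    (h' : μ⁻¹ * ν ∈ parabolic (n := n) k) : σ⁻¹ * ν ∈ parabolic (n := n) k := by
  have := mul_mem h h'
  rwa [mul_assoc, mul_inv_cancel_left] at this

theorem inv_mul_mem_symm {σ μ : Perm (Fin n)} (h : σ⁻¹ * μ ∈ parabolic (n := n) k) :
    μ⁻¹ * σ ∈ parabolic (n := n) k := by
  have := inv_mem h
  rwa [mul_inv_rev, inv_inv] at this

variable (k) in
-- Right multiplication by s_i at an ascent inside a block goes up in the Bruhat order and stays in
-- the coset; since the length is bounded, the climb stops.
theorem exists_descents (μ : Perm (Fin n)) : ∃ ζ : Perm (Fin n),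
    μ⁻¹ * ζ ∈ parabolic (n := n) k ∧ BruhatLE μ ζ ∧
      ∀ a b : Fin n, SameBlock k a b → ζ b < ζ a := by
  induction hd : n * n - inv μ using Nat.strong_induction_on generalizing μ with
  | _ d ih =>
    by_cases h : ∀ i : Fin (n - 1), (∀ j, k j ≠ i + 1) → μ (pos' i) < μ (pos i)
    · refine ⟨μ, by rw [inv_mul_cancel]; exact one_mem _, bruhatLE_refl _, fun a b hab => ?_⟩
      exact sameBlock_of_adjacent (P := fun a b => μ b < μ a) (fun _ _ _ h1 h2 => h2.trans h1) h hab
    · push Not at h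
      obtain ⟨i, hi, h⟩ := h
      have h := lt_of_le_of_ne h (apply_pos_ne μ i)
      have hinv := inv_mul_simple h
      have hbound := inv_le (μ * simple i)
      obtain ⟨ζ, h1, h2, h3⟩ := ih _ (by omega) (μ * simple i) rfl
      refine ⟨ζ, inv_mul_mem_trans (inv_mul_mul_simple_mem ?_ hi) h1,
        (bruhatLE_mul_simple h).trans h2, h3⟩
      rw [inv_mul_cancel]; exact one_mem _

variable (k) in
theorem exists_ascents (μ : Perm (Fin n)) : ∃ α : Perm (Fin n),
    μ⁻¹ * α ∈ parabolic (n := n) k ∧ BruhatLE α μ ∧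
      ∀ a b : Fin n, SameBlock k a b → α a < α b := by
  induction hd : inv μ using Nat.strong_induction_on generalizing μ with
  | _ d ih =>
    by_cases h : ∀ i : Fin (n - 1), (∀ j, k j ≠ i + 1) → μ (pos i) < μ (pos' i)
    · refine ⟨μ, by rw [inv_mul_cancel]; exact one_mem _, bruhatLE_refl _, fun a b hab => ?_⟩
      exact sameBlock_of_adjacent (P := fun a b => μ a < μ b) (fun _ _ _ => lt_trans) h hab
    · push Not at h
      obtain ⟨i, hi, h⟩ := h
      have h := lt_of_le_of_ne h (apply_pos_ne μ i).symm
      have hinv := inv_mul_simple' h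
      obtain ⟨α, h1, h2, h3⟩ := ih _ (by omega) (μ * simple i) rfl
      refine ⟨α, inv_mul_mem_trans (inv_mul_mul_simple_mem ?_ hi) h1,
        h2.trans (mul_simple_bruhatLE h), h3⟩
      rw [inv_mul_cancel]; exact one_mem _

/-- Climbing from any element of the coset ends at the same permutation, because `eq_of_descents`
allows only one that decreases on every block. -/
theorem existsUnique_isCosetMax (σ : Perm (Fin n)) : ∃! ζ : Perm (Fin n), IsCosetMax k σ ζ := by
  obtain ⟨ζ, h1, -, h3⟩ := exists_descents k σ
  have hmax : IsCosetMax k σ ζ := by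
    refine ⟨h1, fun μ hμ => ?_⟩
    obtain ⟨ζ', h1', h2', h3'⟩ := exists_descents k μ
    have : ζ = ζ' := eq_of_descents
      (inv_mul_mem_trans (inv_mul_mem_symm h1) (inv_mul_mem_trans hμ h1')) h3 h3'
    rwa [this]
  exact ⟨ζ, hmax, fun ζ' h' => (hmax.2 ζ' h'.1).antisymm (h'.2 ζ hmax.1)⟩

theorem IsCosetMax.descents {σ ζ : Perm (Fin n)} (h : IsCosetMax k σ ζ) :
    ∀ a b : Fin n, SameBlock k a b → ζ b < ζ a := by
  intro a b hab
  refine sameBlock_of_adjacent (P := fun a b => ζ b < ζ a) (fun _ _ _ h1 h2 => h2.trans h1)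
    (fun i hi => ?_) hab
  refine lt_of_le_of_ne (not_lt.1 fun hlt => ?_) (apply_pos_ne ζ i).symm
  have h1 := (h.2 _ (inv_mul_mul_simple_mem h.1 hi)).inv_le
  rw [inv_mul_simple hlt] at h1
  omega

end Coset

/-! ### Uniqueness of valid words and closure under intervals -/

section Intervals

variable {n m : ℕ} {k : Fin m → ℕ}

theorem pathCount_le_append (L L' : List (Fin n × Fin n)) (σ μ : Perm (Fin n)) :
    pathCount L' σ μ ≤ pathCount (L ++ L') σ μ := by
  induction L with
  | nil => exact le_rfl
  | cons p L ih => rw [List.cons_append, pathCount]; omega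

theorem mem_parabolic_of_pathCount_pos {L : List (Fin n × Fin n)}
    (hL : ∀ p ∈ L, SameBlock k p.1 p.2) {σ μ : Perm (Fin n)} (h : 0 < pathCount L σ μ) :
    σ⁻¹ * μ ∈ parabolic (n := n) k := by
  induction L generalizing σ with
  | nil =>
    rw [pathCount] at h
    split_ifs at h with e
    · rw [e, inv_mul_cancel]; exact one_mem _
    · exact absurd h (lt_irrefl _)
  | cons p L ih =>
    have hL' : ∀ q ∈ L, SameBlock k q.1 q.2 := fun q hq => hL q (by simp [hq])
    rw [pathCount, Nat.add_pos_iff_pos_or_pos] at h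
    rcases h with h | h
    · exact ih hL' h
    · split_ifs at h with hc
      · refine inv_mul_mem_trans ?_ (ih hL' h)
        rw [inv_mul_cancel_left]
        exact swap_mem_parabolic (hL p (by simp))
      · exact absurd h (lt_irrefl _)

/-- The number of cuts to the right of a position. -/
def cutsRight (k : Fin m → ℕ) (a : ℕ) : ℕ := (Finset.univ.filter fun j => a < k j).card

/-- The sum of the values, weighted by the number of cuts to the right of their positions. -/
def cutWeight (k : Fin m → ℕ) (σ : Perm (Fin n)) : ℤ :=
  ∑ a : Fin n, ((σ a).val : ℤ) * cutsRight k a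

theorem cutWeight_mul (σ g : Perm (Fin n)) : cutWeight k (σ * g) =
    ∑ a : Fin n, ((σ a).val : ℤ) * cutsRight k (g⁻¹ a : Fin n) := by
  rw [cutWeight, ← Equiv.sum_comp g fun a => ((σ a).val : ℤ) * cutsRight k (g⁻¹ a : Fin n)]
  refine Finset.sum_congr rfl fun a _ => ?_
  rw [Perm.mul_apply, show g⁻¹ (g a) = a from g.symm_apply_apply a]

theorem cutWeight_mul_parabolic {g : Perm (Fin n)} (hg : g ∈ parabolic (n := n) k)
    (σ : Perm (Fin n)) : cutWeight k (σ * g) = cutWeight k σ := by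
  rw [cutWeight_mul, cutWeight]
  refine Finset.sum_congr rfl fun a _ => ?_
  have : cutsRight k (g⁻¹ a : Fin n) = cutsRight k a :=
    congrArg Finset.card (Finset.filter_congr fun j _ => inv_mem hg j a)
  rw [this]

/-- The larger value moves to position a, which has more cuts to its right than b. -/
theorem cutWeight_lt_of_cov {σ : Perm (Fin n)} {a b : Fin n} (h : Cov σ a b)
    (hk : ∃ j, a.val < k j ∧ k j ≤ b.val) : cutWeight k σ < cutWeight k (σ * swap a b) := by
  have hlt : cutsRight k b < cutsRight k a := by
    obtain ⟨j, h1, h2⟩ := hk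
    refine Finset.card_lt_card ((Finset.ssubset_iff_of_subset ?_).2 ⟨j, ?_, ?_⟩)
    · intro j
      have := h.1
      simp only [Finset.mem_filter, Finset.mem_univ, true_and, Fin.lt_def] at this ⊢
      omega
    · simpa using h1
    · simpa using h2
  rw [← sub_pos, cutWeight_mul, cutWeight, ← Finset.sum_sub_distrib,
    Fintype.sum_eq_add a b h.1.ne]
  · have hv : ((σ a).val : ℤ) < (σ b).val := by exact_mod_cast h.2.1
    have hlt' : (cutsRight k b : ℤ) < cutsRight k a := by exact_mod_cast hlt
    rw [swap_inv, swap_apply_left, swap_apply_right]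
    nlinarith [mul_pos (sub_pos.2 hv) (sub_pos.2 hlt')]
  · rintro c ⟨h1, h2⟩
    rw [swap_inv, swap_apply_of_ne_of_ne h1 h2, sub_self]

theorem eq_or_cutWeight_lt {L : List (Fin n × Fin n)}
    (hL : ∀ p ∈ L, ∃ j, p.1.val < k j ∧ k j ≤ p.2.val) {σ μ : Perm (Fin n)}
    (h : 0 < pathCount L σ μ) : σ = μ ∨ cutWeight k σ < cutWeight k μ := by
  induction L generalizing σ with
  | nil =>
    rw [pathCount] at h
    split_ifs at h with e
    · exact Or.inl e
    · exact absurd h (lt_irrefl _)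
  | cons p L ih =>
    have hL' : ∀ q ∈ L, ∃ j, q.1.val < k j ∧ k j ≤ q.2.val := fun q hq => hL q (by simp [hq])
    rw [pathCount, Nat.add_pos_iff_pos_or_pos] at h
    rcases h with h | h
    · exact ih hL' h
    · split_ifs at h with hc
      · right
        have h1 := cutWeight_lt_of_cov hc (hL p (by simp))
        rcases ih hL' h with h2 | h2
        · rwa [h2] at h1
        · exact h1.trans h2
      · exact absurd h (lt_irrefl _)

/-- The weight is constant on cosets, yet every letter of 𝒲 crosses a cut and raises it; a path that
ends in its own coset is therefore empty. -/
theorem eq_of_pathCount_transpList_pos {σ μ : Perm (Fin n)}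
    (h : 0 < pathCount (transpList n k) σ μ) (hμ : σ⁻¹ * μ ∈ parabolic (n := n) k) : σ = μ := by
  rcases eq_or_cutWeight_lt (fun p hp => (mem_transpList hp).2) h with h | h
  · exact h
  · have := cutWeight_mul_parabolic hμ σ
    rw [mul_inv_cancel_left] at this
    omega

theorem pathCount_transpList_le_one (hk : StrictMono k) (hn : ∀ j, k j < n)
    (σ μ : Perm (Fin n)) : pathCount (transpList n k) σ μ ≤ 1 := by
  obtain ⟨L, -, e⟩ := full_eq_mul_transpList (R := ℤ) hk hn
  refine (pathCount_le_append L _ σ μ).trans ?_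
  rw [pathCount_eq_ite e]
  split_ifs <;> simp

/-- A Bruhat relation factors through the coset of the smaller element. -/
theorem exists_coset_factor (hk : StrictMono k) (hn : ∀ j, k j < n) {σ μ : Perm (Fin n)}
    (h : BruhatLE σ μ) : ∃ γ, σ⁻¹ * γ ∈ parabolic (n := n) k ∧ BruhatLE σ γ ∧
      0 < pathCount (transpList n k) γ μ := by
  obtain ⟨L, hL, e⟩ := full_eq_mul_transpList (R := ℤ) hk hn
  have h1 : 0 < pathCount (L ++ transpList n k) σ μ := by
    rw [pathCount_eq_ite e, if_pos h]; exact one_pos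
  obtain ⟨γ, h2, h3⟩ := pathCount_append_pos.1 h1
  exact ⟨γ, mem_parabolic_of_pathCount_pos hL h2, bruhatLE_of_pathCount_pos h2, h3⟩

/-- The sets of endpoints of valid words starting in the same coset are disjoint. -/
theorem eq_of_pathCount_pos (hk : StrictMono k) (hn : ∀ j, k j < n) {β β' μ : Perm (Fin n)}
    (hβ : β⁻¹ * β' ∈ parabolic (n := n) k) (h : 0 < pathCount (transpList n k) β μ)
    (h' : 0 < pathCount (transpList n k) β' μ) : β = β' := by
  obtain ⟨L, hL, e⟩ := full_eq_mul_transpList (R := ℤ) hk hn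
  obtain ⟨α, h1, h2, h3⟩ := exists_ascents k β
  obtain ⟨α', h1', h2', h3'⟩ := exists_ascents k β'
  have hα : α = α' := eq_of_ascents
    (inv_mul_mem_trans (inv_mul_mem_symm h1) (inv_mul_mem_trans hβ h1')) h3 h3'
  -- From the coset minimum α, the path to γ consists of inner letters alone: its second part would
  -- start and end in the same coset.
  have key : ∀ γ, α⁻¹ * γ ∈ parabolic (n := n) k → BruhatLE α γ → 0 < pathCount L α γ := by
    intro γ hγ hle
    have h4 : 0 < pathCount (L ++ transpList n k) α γ := by
      rw [pathCount_eq_ite e, if_pos hle]; exact one_pos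
    obtain ⟨δ, h5, h6⟩ := pathCount_append_pos.1 h4
    have h7 := eq_of_pathCount_transpList_pos h6
      (inv_mul_mem_trans (inv_mul_mem_symm (mem_parabolic_of_pathCount_pos hL h5)) hγ)
    rwa [h7] at h5
  by_contra hne
  -- Both β and β' would be intermediate points of paths from α to μ, against the uniqueness of such
  -- a path.
  have h8 := pathCount_append_add hne (key β (inv_mul_mem_symm h1) h2)
    (key β' (hα ▸ inv_mul_mem_symm h1') (hα ▸ h2')) h h'
  rw [pathCount_eq_ite e] at h8
  split_ifs at h8 <;> omega

/-- Every α ≤ μ lies below an element of its own coset from which μ is reached along 𝒲, and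
disjointness leaves only one such element in the coset. -/
theorem pathCount_transpList_pos_iff (hk : StrictMono k) (hn : ∀ j, k j < n)
    {σ μ : Perm (Fin n)} : 0 < pathCount (transpList n k) σ μ ↔
      BruhatLE σ μ ∧ ∀ α, σ⁻¹ * α ∈ parabolic (n := n) k → BruhatLE α μ → BruhatLE α σ := by
  constructor
  · intro h
    refine ⟨bruhatLE_of_pathCount_pos h, fun α hα hle => ?_⟩
    obtain ⟨γ, h1, h2, h3⟩ := exists_coset_factor hk hn hle
    rwa [eq_of_pathCount_pos hk hn (inv_mul_mem_trans hα h1) h h3]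
  · rintro ⟨h, h'⟩
    obtain ⟨γ, h1, h2, h3⟩ := exists_coset_factor hk hn h
    rwa [h2.antisymm (h' γ h1 (bruhatLE_of_pathCount_pos h3))]

theorem mem_validSubwords {σ : Perm (Fin n)} {w : List (Fin n × Fin n)} :
    w ∈ validSubwords k σ ↔ w.Sublist (transpList n k) ∧ IsBruhatPath σ w := by
  simp [validSubwords]

theorem mem_summationSet {σ μ : Perm (Fin n)} :
    μ ∈ summationSet k σ ↔ 0 < pathCount (transpList n k) σ μ := by
  rw [pathCount_pos_iff fun p hp => (mem_transpList hp).1]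
  simp only [summationSet, Set.mem_ofPred_eq, mem_validSubwords, and_assoc]

theorem injOn_mulWord (hk : StrictMono k) (hn : ∀ j, k j < n) (σ : Perm (Fin n)) :
    Set.InjOn (mulWord σ) (validSubwords k σ : Set (List (Fin n × Fin n))) := by
  intro w hw w' hw' h
  rw [Finset.mem_coe, mem_validSubwords] at hw hw'
  exact eq_of_pathCount_le_one (fun p hp => (mem_transpList hp).1)
    (pathCount_transpList_le_one hk hn σ _) hw.1 hw.2 rfl hw'.1 hw'.2 h.symm

theorem chainSum_apply {R : Type*} [CommRing R] (hk : StrictMono k) (hn : ∀ j, k j < n)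
    (σ μ : Perm (Fin n)) : (μ ∈ summationSet k σ ∧
        (chainSum R k σ μ = 1 ∨ chainSum R k σ μ = -1)) ∨
      (μ ∉ summationSet k σ ∧ chainSum R k σ μ = 0) := by
  rw [mem_summationSet, chainSum_eq_act hk, act_listOp_apply]
  have := pathCount_transpList_le_one hk hn σ μ
  rcases Nat.eq_zero_or_pos (pathCount (transpList n k) σ μ) with h | h
  · right
    simp [h]
  · left
    rw [show pathCount (transpList n k) σ μ = 1 by omega]
    simpa using neg_one_pow_eq_or R (inv σ + inv μ)

theorem support_chainSum {R : Type*} [CommRing R] [Nontrivial R] (hk : StrictMono k)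
    (hn : ∀ j, k j < n) (σ : Perm (Fin n)) :
    ((chainSum R k σ).support : Set (Perm (Fin n))) = summationSet k σ := by
  ext μ
  rw [Finset.mem_coe, Finsupp.mem_support_iff]
  rcases chainSum_apply (R := R) hk hn σ μ with ⟨h1, h2⟩ | ⟨h1, h2⟩
  · simp only [h1, iff_true]
    rcases h2 with h2 | h2 <;> simp [h2]
  · simp [h1, h2]

/-- The lower bound is inherited from ν₁, the condition on the coset from ν₂. -/
theorem summationSet_ordConnected (hk : StrictMono k) (hn : ∀ j, k j < n)
    {σ ν₁ ν₂ μ : Perm (Fin n)} (h1 : ν₁ ∈ summationSet k σ) (h2 : ν₂ ∈ summationSet k σ)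
    (h3 : BruhatLE ν₁ μ) (h4 : BruhatLE μ ν₂) : μ ∈ summationSet k σ := by
  rw [mem_summationSet, pathCount_transpList_pos_iff hk hn] at h1 h2 ⊢
  exact ⟨h1.1.trans h3, fun α hα hle => h2.2 α hα (hle.trans h4)⟩

end Intervals

/-! ### An example that is not an interval -/

section NonInterval

/-- The maximal length of a Bruhat path from `σ` that is a subword of the list. -/
def maxPathLength {n : ℕ} : List (Fin n × Fin n) → Perm (Fin n) → ℕ
  | [], _ => 0
  | p :: L, σ => max (maxPathLength L σ)
      (if Cov σ p.1 p.2 then maxPathLength L (σ * swap p.1 p.2) + 1 else 0)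

theorem inv_le_of_pathCount_pos {n : ℕ} {L : List (Fin n × Fin n)} {σ μ : Perm (Fin n)}
    (h : 0 < pathCount L σ μ) : inv μ ≤ inv σ + maxPathLength L σ := by
  induction L generalizing σ with
  | nil =>
    rw [pathCount] at h
    split_ifs at h with e
    · simp [e]
    · exact absurd h (lt_irrefl _)
  | cons p L ih =>
    rw [pathCount, Nat.add_pos_iff_pos_or_pos] at h
    rw [maxPathLength]
    rcases h with h | h
    · exact (ih h).trans (by omega)
    · split_ifs at h ⊢ with hc
      · have := ih h
        rw [hc.inv_eq] at this
        omega
      · exact absurd h (lt_irrefl _)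

/-- A set of endpoints with two elements at the maximal distance from the start is not an
interval. -/
theorem not_interval {n m : ℕ} {k : Fin m → ℕ} {σ ν ν' : Perm (Fin n)} (hne : ν ≠ ν')
    (h1 : 0 < pathCount (transpList n k) σ ν) (h2 : 0 < pathCount (transpList n k) σ ν')
    (hν : inv σ + maxPathLength (transpList n k) σ ≤ inv ν)
    (hν' : inv σ + maxPathLength (transpList n k) σ ≤ inv ν') :
    ¬ ∃ α β : Perm (Fin n), summationSet k σ = {μ | BruhatLE α μ ∧ BruhatLE μ β} := by
  rintro ⟨α, β, h⟩
  rw [← mem_summationSet, h] at h1 h2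
  -- The top β would itself be an endpoint, hence no longer than ν and ν'. Both lie below β, so both
  -- would equal β.
  have hβ : β ∈ summationSet k σ := by
    rw [h]
    exact ⟨h1.1.trans h1.2, bruhatLE_refl β⟩
  have hle := inv_le_of_pathCount_pos (mem_summationSet.1 hβ)
  refine hne ?_
  rcases h1.2.eq_or_inv_lt with e | e
  · rcases h2.2.eq_or_inv_lt with e' | e'
    · rw [e, e']
    · omega
  · omega

theorem exists_not_interval : ∃ (n m : ℕ) (k : Fin m → ℕ) (σ : Perm (Fin n)),
    StrictMono k ∧ (∀ j, 1 ≤ k j ∧ k j < n) ∧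
      ¬ ∃ α β : Perm (Fin n), summationSet k σ = {μ | BruhatLE α μ ∧ BruhatLE μ β} := by
  have hlist : transpList 4 ![1, 3] = [(1, 3), (2, 3), (0, 3), (0, 2), (0, 1)] := by decide
  -- In one-line notation σ = 2143; the two endpoints are 4132 and 3241, each two steps above σ, the
  -- longest possible.
  refine ⟨4, 2, ![1, 3], swap 0 1 * swap 2 3, by decide, by decide, ?_⟩
  apply not_interval (ν := swap 0 1 * swap 2 3 * swap 0 3 * swap 0 2)
    (ν' := swap 0 1 * swap 2 3 * swap 1 3 * swap 0 1)
  · decide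
  · rw [hlist]; decide
  · rw [hlist]; decide
  · rw [hlist]; decide
  · rw [hlist]; decide

end NonInterval

end ZeroHecke

open ZeroHecke in
theorem proposition4p4p3 {R : Type*} [CommRing R] [Nontrivial R] :
    (∀ (n m : ℕ) (k : Fin m → ℕ), StrictMono k → (∀ j, 1 ≤ k j ∧ k j < n) →
      ∀ σ : Equiv.Perm (Fin n),
        -- the coset has exactly one maximal element
        (∃! ζ : Equiv.Perm (Fin n), IsCosetMax k σ ζ) ∧
        -- the expansion, for all reduced decompositions `u` of `ω ζ` and `v` of `ζ⁻¹ σ`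
        (∀ ζ : Equiv.Perm (Fin n), IsCosetMax k σ ζ →
          ∀ u v : List (Fin (n - 1)),
            IsReducedWord u (omega n * ζ) → IsReducedWord v (ζ⁻¹ * σ) →
              piWord (piHatWord (K R (omega n)) u) v = chainSum R k σ) ∧
        -- no cancellation: each permutation is reached by at most one valid subword
        Set.InjOn (mulWord σ) (validSubwords k σ : Set (List (Fin n × Fin n))) ∧
        -- the permutations occurring in the sum, with coefficients `1` or `-1`
        (((chainSum R k σ).support : Set (Equiv.Perm (Fin n))) = summationSet k σ) ∧
        (∀ ν ∈ summationSet k σ, chainSum R k σ ν = 1 ∨ chainSum R k σ ν = -1) ∧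
        -- closure under intervals
        (∀ ν₁ ∈ summationSet k σ, ∀ ν₂ ∈ summationSet k σ, ∀ μ : Equiv.Perm (Fin n),
          BruhatLE ν₁ μ → BruhatLE μ ν₂ → μ ∈ summationSet k σ)) ∧
    -- in general the set is not an interval
    (∃ (n m : ℕ) (k : Fin m → ℕ) (σ : Equiv.Perm (Fin n)),
      StrictMono k ∧ (∀ j, 1 ≤ k j ∧ k j < n) ∧
        ¬ ∃ α β : Equiv.Perm (Fin n),
          summationSet k σ = {μ | BruhatLE α μ ∧ BruhatLE μ β}) := by
  refine ⟨fun n m k hk hkn σ => ?_, exists_not_interval⟩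
  have hn : ∀ j, k j < n := fun j => (hkn j).2
  refine ⟨existsUnique_isCosetMax σ, fun ζ hζ u v hu hv => ?_, injOn_mulWord hk hn σ,
    support_chainSum hk hn σ, fun ν hν => ?_,
    fun ν₁ h1 ν₂ h2 μ h3 h4 => summationSet_ordConnected hk hn h1 h2 h3 h4⟩
  · rw [chainSum_eq_act hk]
    exact expansion hk hn hζ.descents (inv_mul_mem_symm hζ.1) hu hv
  · rcases chainSum_apply (R := R) hk hn σ ν with h | h
    · exact h.2
    · exact absurd hν h.1
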